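/- All graphs are finite and simple; $\chi(G)$ and $\omega(G)$ denote the chromatic number and the clique number of $G$, and a graph is $H$-free if it has no induced subgraph isomorphic to $H$. A star is a tree in which one vertex is adjacent to all the others; a star-forest is a forest in which every component is a star; a double star is a tree with exactly two internal vertices, that is, exactly two vertices of degree at least two. Theorem. Let $H'$ be a double star, and let $H$ be the disjoint union of $H'$ and a star-forest. Then there is a polynomial $f_H$ such that $\chi(G)\le f_H(\omega(G))$ for every $H$-free graph $G$. -/

import Mathlib

open scoped SimpleGraph

universe u u₁ u₂ w

namespace PolyChi

/-- A star is a tree in which one vertex is adjacent to all the others. -/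
def IsStar {V : Type*} (G : SimpleGraph V) : Prop :=
  G.IsTree ∧ ∃ c : V, ∀ v : V, v ≠ c → G.Adj c v

/-- A star-forest is a forest in which every component is a star. -/
def IsStarForest {V : Type*} (G : SimpleGraph V) : Prop :=
  G.IsAcyclic ∧ ∀ C : G.ConnectedComponent, IsStar C.toSimpleGraph

/-- The internal vertices are those with at least two neighbours. -/
def internalVertices {V : Type*} (G : SimpleGraph V) : Set V :=
  {v | (G.neighborSet v).Nontrivial}

/-- A double star is a tree with (exactly) two internal vertices. -/
def IsDoubleStar {V : Type*} (G : SimpleGraph V) : Prop :=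
  G.IsTree ∧ (internalVertices G).ncard = 2

/-- `G` is `H`-free if it has no induced subgraph isomorphic to `H`. -/
def IsHFree {W V : Type*} (H : SimpleGraph W) (G : SimpleGraph V) : Prop :=
  ¬ H.IsIndContained G

/-- `H` satisfies Esperet's conjecture: some polynomial in the clique number bounds the chromatic
number of every finite `H`-free graph. (Natural coefficients are no loss: dropping the signs of the
coefficients of a real polynomial and rounding them up only increases its values on `ℕ`.) -/
def SatisfiesEsperet {W : Type u} (H : SimpleGraph W) : Prop :=
  ∃ f : Polynomial ℕ, ∀ (V : Type w) [Finite V] (G : SimpleGraph V),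
    IsHFree H G → G.chromaticNumber ≤ ((f.eval G.cliqueNum : ℕ) : ℕ∞)

end PolyChi

/-!
Every double star embeds as an induced subgraph in a symmetric one with `s` leaves at either
internal vertex, and every star-forest in a disjoint union of equal stars, so it suffices to show
that symmetric double stars satisfy Esperet's conjecture (`satisfiesEsperet_doubleStar`) and that the
conjecture survives the addition of a disjoint star (`SatisfiesEsperet.sum_star`). Let `τ` bound the
cliques of `G`; every bound below is polynomial in `τ` for fixed `s`.

In both arguments the first step is to force stable sets of prescribed size `t` in sets of
polynomial size (`forcesStable_of_starAntiBdd`, `forcesStable_of_doubleStarBdd`). For the double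
star this is done by counting induced four-vertex paths: without large stable sets they are so
numerous that some edge `b c` is the middle edge of many paths, and the outer ends of these paths
contain the leaves of a double star. The stable sets are assembled into *templates*, which are
approximate complete multipartite graphs; a template contains a clique with one vertex from each
part, hence has at most `τ` parts, and one can take a template that has no successor with one part
more.

*Adding a star.* The vertices anticomplete to a star inside a template that cannot be extended are
coloured by hypothesis. Any other vertex is nearly complete to all parts but at most one. There are
few that are nearly complete to all parts, and those nearly complete to all parts but `X j` contain
no two-part template, since it could replace `X j`. A set without two-part templates is coloured by
passing repeatedly to the neighbourhood of a vertex (`colBdd_of_no_pair`, `colBdd_of_starAntiBdd`).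

*Double stars.* The trace of a vertex is the set of parts of the template in which it misses many
vertices. After the removal of few vertices, the traces that are not empty form a laminar family
(`Template.subset_or_subset_of_crossing`), and a vertex whose trace is neither empty nor full has
few neighbours with full trace (`Template.card_full_trace_lt`).
Vertices with disjoint traces are separated by an edge of the template, so two sets `A`, `B` with
disjoint traces are, apart from few vertices, such that cliques of `A` and of `B` combine: their
clique numbers add up to at most that of the whole (`exists_split`). Hence from any set one can peel
off a nonempty `A ∪ B` whose vertices have few neighbours in the rest, with the clique numbers of
`A` and `B` smaller than that of the set and with sum at most it (`exists_peel`). Such a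
decomposition yields a polynomial colouring: a colour is a pair, `A` and `B` use disjoint sets of
first coordinates, and the second coordinate avoids the few colours already used by neighbours
outside `A ∪ B` (`colBdd_of_peel`).
-/

namespace PolyChi

/-! ### Cliques, stable sets, colourings and templates -/

section Basics
open Classical

variable {V : Type*}

/-- Every clique of `G` inside the finite set `Z` has at most `w` vertices. -/
def CliqueBdd (G : SimpleGraph V) (Z : Finset V) (w : ℕ) : Prop :=
  ∀ K ⊆ Z, G.IsClique (K : Set V) → K.card ≤ w

/-- Every set of at least `n` vertices of `G` contains a stable set of exactly `t` vertices. -/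
def ForcesStable (G : SimpleGraph V) (n t : ℕ) : Prop :=
  ∀ T : Finset V, n ≤ T.card → ∃ S ⊆ T, S.card = t ∧ G.IsIndepSet (S : Set V)

/-- The subgraph of `G` induced on the finite set `Z` is `n`-colourable; the colours are natural
numbers below `n`, and the values of the colouring outside `Z` are irrelevant. -/
def ColBdd (G : SimpleGraph V) (Z : Finset V) (n : ℕ) : Prop :=
  ∃ c : V → ℕ, (∀ v ∈ Z, c v < n) ∧ ∀ u ∈ Z, ∀ v ∈ Z, G.Adj u v → c u ≠ c v

/-- The neighbours of `v` in `T`. -/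
noncomputable def hits (G : SimpleGraph V) (v : V) (T : Finset V) : Finset V :=
  T.filter fun x => G.Adj v x

/-- The non-neighbours of `v` in `T` (including `v` itself if it lies in `T`). -/
noncomputable def misses (G : SimpleGraph V) (v : V) (T : Finset V) : Finset V :=
  T.filter fun x => ¬ G.Adj v x

@[simp] lemma mem_hits {G : SimpleGraph V} {v x : V} {T : Finset V} :
    x ∈ hits G v T ↔ x ∈ T ∧ G.Adj v x := by simp [hits]

@[simp] lemma mem_misses {G : SimpleGraph V} {v x : V} {T : Finset V} :
    x ∈ misses G v T ↔ x ∈ T ∧ ¬ G.Adj v x := by simp [misses]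

lemma hits_subset (G : SimpleGraph V) (v : V) (T : Finset V) : hits G v T ⊆ T :=
  Finset.filter_subset _ _

lemma misses_subset (G : SimpleGraph V) (v : V) (T : Finset V) : misses G v T ⊆ T :=
  Finset.filter_subset _ _

lemma card_hits_add_card_misses (G : SimpleGraph V) (v : V) (T : Finset V) :
    (hits G v T).card + (misses G v T).card = T.card :=
  Finset.card_filter_add_card_filter_not _

lemma misses_mono (G : SimpleGraph V) (v : V) {S T : Finset V} (h : S ⊆ T) :
    misses G v S ⊆ misses G v T := Finset.filter_subset_filter _ h

lemma CliqueBdd.mono {G : SimpleGraph V} {Z Z' : Finset V} {w w' : ℕ} (h : CliqueBdd G Z w)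
    (hZ : Z' ⊆ Z) (hw : w ≤ w') : CliqueBdd G Z' w' :=
  fun K hK hc => (h K (hK.trans hZ) hc).trans hw

lemma isIndepSet_mono {G : SimpleGraph V} {S T : Finset V} (hT : G.IsIndepSet (T : Set V))
    (h : S ⊆ T) : G.IsIndepSet (S : Set V) := Set.Pairwise.mono (by exact_mod_cast h) hT

lemma not_adj_of_isIndepSet {G : SimpleGraph V} {S : Finset V} (hS : G.IsIndepSet (S : Set V))
    {x y : V} (hx : x ∈ S) (hy : y ∈ S) : ¬ G.Adj x y := fun h =>
  hS (by exact_mod_cast hx) (by exact_mod_cast hy) h.ne h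

lemma ColBdd.mono {G : SimpleGraph V} {Z Z' : Finset V} {n n' : ℕ} (h : ColBdd G Z n)
    (hZ : Z' ⊆ Z) (hn : n ≤ n') : ColBdd G Z' n' := by
  obtain ⟨c, h1, h2⟩ := h
  exact ⟨c, fun v hv => (h1 v (hZ hv)).trans_le hn, fun u hu v hv => h2 u (hZ hu) v (hZ hv)⟩

lemma ColBdd.union {G : SimpleGraph V} {Z Z' : Finset V} {n n' : ℕ} (h : ColBdd G Z n)
    (h' : ColBdd G Z' n') : ColBdd G (Z ∪ Z') (n + n') := by
  obtain ⟨c, h1, h2⟩ := h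
  obtain ⟨c', h1', h2'⟩ := h'
  have key : ∀ v ∈ Z ∪ Z', v ∉ Z → v ∈ Z' := fun v hv hz =>
    (Finset.mem_union.1 hv).resolve_left hz
  refine ⟨fun v => if v ∈ Z then c v else n + c' v, fun v hv => ?_, fun u hu v hv huv => ?_⟩
  · by_cases hz : v ∈ Z
    · have := h1 v hz; simp only [hz, if_true]; omega
    · have := h1' v (key v hv hz); simp only [hz, if_false]; omega
  · by_cases hzu : u ∈ Z <;> by_cases hzv : v ∈ Z <;> simp only [hzu, hzv, if_true, if_false]
    · exact h2 u hzu v hzv huv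
    · have := h1 u hzu; omega
    · have := h1 v hzv; omega
    · have := h2' u (key u hu hzu) v (key v hv hzv) huv; omega

lemma colBdd_empty (G : SimpleGraph V) (n : ℕ) : ColBdd G ∅ n :=
  ⟨fun _ => 0, by simp, by simp⟩

lemma ColBdd.biUnion {G : SimpleGraph V} {ι : Type*} (Q : Finset ι) (Z : ι → Finset V) {n : ℕ}
    (h : ∀ i ∈ Q, ColBdd G (Z i) n) : ColBdd G (Q.biUnion Z) (Q.card * n) := by
  induction Q using Finset.induction_on with
  | empty => simpa using colBdd_empty G 0
  | insert a Q ha ih =>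
    rw [Finset.biUnion_insert, Finset.card_insert_of_notMem ha]
    refine ((h a (by simp)).union (ih fun i hi => h i (by simp [hi]))).mono subset_rfl ?_
    linarith [add_mul Q.card 1 n]

lemma colBdd_singleton (G : SimpleGraph V) (v : V) : ColBdd G {v} 1 :=
  ⟨fun _ => 0, by simp, by simp⟩

lemma colBdd_card (G : SimpleGraph V) (Z : Finset V) : ColBdd G Z Z.card := by
  have := ColBdd.biUnion (G := G) Z (fun v => {v}) fun i _ => colBdd_singleton G i
  simpa using this

/-- A finite set that is `n`-colourable has a colour class with at least a `1/n` fraction of its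
vertices. -/
lemma ColBdd.exists_stable {G : SimpleGraph V} {Z : Finset V} {n t : ℕ} (h : ColBdd G Z n)
    (ht : n * t < Z.card) : ∃ S ⊆ Z, S.card = t ∧ G.IsIndepSet (S : Set V) := by
  obtain ⟨c, h1, h2⟩ := h
  obtain ⟨y, _, hy⟩ := Finset.exists_lt_card_fiber_of_mul_lt_card_of_maps_to
    (s := Z) (t := Finset.range n) (f := c) (n := t) (fun a ha => by simpa using h1 a ha)
    (by simpa using ht)
  obtain ⟨S, hS, hSc⟩ := Finset.exists_subset_card_eq hy.le
  refine ⟨S, hS.trans (Finset.filter_subset _ _), hSc, fun a ha b hb _ hab => ?_⟩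
  have ha' := Finset.mem_filter.1 (hS (by exact_mod_cast ha))
  have hb' := Finset.mem_filter.1 (hS (by exact_mod_cast hb))
  exact h2 a ha'.1 b hb'.1 hab (ha'.2.trans hb'.2.symm)

/-- A set all of whose vertices have fewer than `d` neighbours in it is greedily `d`-colourable. -/
lemma colBdd_of_degree {G : SimpleGraph V} {d : ℕ} (Z : Finset V)
    (h : ∀ v ∈ Z, (hits G v Z).card < d) : ColBdd G Z d := by
  induction Z using Finset.induction_on with
  | empty => exact colBdd_empty G d
  | insert a Z ha ih =>
    obtain ⟨c, h1, h2⟩ := ih fun v hv =>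
      (Finset.card_le_card (Finset.filter_subset_filter _ (Finset.subset_insert a Z))).trans_lt
        (h v (Finset.mem_insert_of_mem hv))
    have hlt : ((hits G a Z).image c).card < (Finset.range d).card := by
      rw [Finset.card_range]
      refine Finset.card_image_le.trans_lt (lt_of_le_of_lt (Finset.card_le_card ?_)
        (h a (Finset.mem_insert_self a Z)))
      exact Finset.filter_subset_filter _ (Finset.subset_insert a Z)
    obtain ⟨k, hk, hk'⟩ := Finset.exists_mem_notMem_of_card_lt_card hlt
    have hne : ∀ v ∈ Z, v ≠ a := fun v hv e => ha (e ▸ hv)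
    have hk2 : ∀ v ∈ Z, G.Adj a v → c v ≠ k := fun v hv hav e =>
      hk' (Finset.mem_image.2 ⟨v, by simp [hv, hav], e⟩)
    refine ⟨Function.update c a k, fun v hv => ?_, fun x hx y hy hxy => ?_⟩
    · rcases Finset.mem_insert.1 hv with rfl | hv
      · simpa using hk
      · simpa [hne v hv] using h1 v hv
    · rcases Finset.mem_insert.1 hx with hxa | hx' <;>
        rcases Finset.mem_insert.1 hy with hya | hy'
      · rw [hxa, hya] at hxy
        exact absurd hxy G.irrefl
      · rw [hxa] at hxy ⊢
        simpa [hne y hy'] using (hk2 y hy' hxy).symm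
      · rw [hya] at hxy ⊢
        simpa [hne x hx'] using hk2 x hx' hxy.symm
      · simpa [hne x hx', hne y hy'] using h2 x hx' y hy' hxy

/-- The union bound, in the form used throughout: if every element of `T` is related to one of the
configurations in `Q`, and no configuration is related to more than `R` elements, then
`|T| ≤ |Q| R`. -/
lemma card_le_of_cover {α β : Type*} (T : Finset α) (Q : Finset β) (rel : α → β → Prop) {R : ℕ}
    (h : ∀ x ∈ T, ∃ c ∈ Q, rel x c)
    (hR : ∀ c ∈ Q, ∀ T' ⊆ T, (∀ x ∈ T', rel x c) → T'.card ≤ R) :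
    T.card ≤ Q.card * R := by
  refine (Finset.card_le_card (t := Q.biUnion fun c => T.filter fun x => rel x c)
    fun x hx => ?_).trans (Finset.card_biUnion_le_card_mul _ _ _ fun c hc =>
      hR c hc _ (Finset.filter_subset _ _) fun x hx => (Finset.mem_filter.1 hx).2)
  obtain ⟨c, hc, hr⟩ := h x hx
  exact Finset.mem_biUnion.2 ⟨c, hc, Finset.mem_filter.2 ⟨hx, hr⟩⟩

lemma card_powersetCard_le {α : Type*} (X : Finset α) (s : ℕ) :
    (X.powersetCard s).card ≤ X.card ^ s := by
  rw [Finset.card_powersetCard]; exact Nat.choose_le_pow _ _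

/-- A recursively defined Ramsey-type bound, polynomial in `τ` for fixed `s`. -/
def ram (τ : ℕ) : ℕ → ℕ
  | 0 => 0
  | s + 1 => τ * (ram τ s + 1) + 1

/-- Fix a maximal clique `K` of the set `T`. Every vertex of `T` has a non-neighbour in `K`, so one
vertex of `K` has a `1/τ` fraction of `T` as its non-neighbours; it is put into the stable set. -/
lemma forcesStable_ram {G : SimpleGraph V} {τ : ℕ}
    (hτ : ∀ K : Finset V, G.IsClique (K : Set V) → K.card ≤ τ) (s : ℕ) :
    ForcesStable G (ram τ s) s := by
  induction s with
  | zero => exact fun T _ => ⟨∅, by simp, by simp, by simp⟩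
  | succ s ih =>
    intro T hT
    obtain ⟨K, hK, hmax⟩ := Finset.exists_max_image
      (T.powerset.filter fun K : Finset V => G.IsClique (K : Set V)) Finset.card ⟨∅, by simp⟩
    simp only [Finset.mem_filter, Finset.mem_powerset] at hK hmax
    have hcov : ∀ x ∈ T, ∃ v ∈ K, ¬ G.Adj v x := by
      intro x hx
      by_contra! hcon
      have hxK : x ∉ K := fun h => (G.irrefl (hcon x h))
      have := hmax (insert x K) ⟨Finset.insert_subset hx hK.1, by
        rw [Finset.coe_insert, SimpleGraph.isClique_insert]
        exact ⟨hK.2, fun b hb _ => (hcon b (by exact_mod_cast hb)).symm⟩⟩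
      rw [Finset.card_insert_of_notMem hxK] at this
      omega
    by_cases hall : ∀ v ∈ K, (misses G v T).card ≤ ram τ s + 1
    · have h1 := card_le_of_cover (R := ram τ s + 1) T K (fun x v => ¬ G.Adj v x) hcov
        fun v hv T' hT' h' => (Finset.card_le_card fun x hx =>
          mem_misses.2 ⟨hT' hx, h' x hx⟩).trans (hall v hv)
      have h2 := Nat.mul_le_mul_right (ram τ s + 1) (hτ K hK.2)
      simp only [ram] at hT
      omega
    · push Not at hall
      obtain ⟨v, hv, hlt⟩ := hall
      obtain ⟨S, hS, hSc, hSi⟩ := ih ((misses G v T).erase v) (by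
        have := Finset.pred_card_le_card_erase (s := misses G v T) (a := v); omega)
      have hvS : v ∉ S := fun h => by simpa using hS h
      refine ⟨insert v S, Finset.insert_subset (hK.1 hv) fun x hx => ?_, ?_, ?_⟩
      · have := hS hx
        simp only [Finset.mem_erase, mem_misses] at this
        exact this.2.1
      · rw [Finset.card_insert_of_notMem hvS, hSc]
      · rw [Finset.coe_insert]
        refine Set.pairwise_insert.2 ⟨hSi, fun b hb _ => ?_⟩
        have := hS (by exact_mod_cast hb)
        simp only [Finset.mem_erase, mem_misses] at this
        exact ⟨this.2.2, fun h => this.2.2 h.symm⟩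

/-- A small set of vertices, each missing few vertices of `X`, has a common neighbour in `X`. -/
lemma exists_common_adj {G : SimpleGraph V} {K X : Finset V} {r : ℕ}
    (h : ∀ x ∈ K, (misses G x X).card ≤ r) (hc : K.card * r < X.card) :
    ∃ p ∈ X, ∀ x ∈ K, G.Adj x p := by
  by_contra! hcon
  have := card_le_of_cover (R := r) X K (fun p x => ¬ G.Adj x p) hcon
    fun x hx T' hT' h' => (Finset.card_le_card fun p hp =>
      mem_misses.2 ⟨hT' hp, h' p hp⟩).trans (h x hx)
  omega

/-- A *template*: for `i ∈ I` the set `X i` is a stable set of `t` vertices, and for `i < j` in `I`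
every vertex of `X j` is adjacent to all but at most `r` vertices of `X i`. So the sets form,
approximately, a complete multipartite graph; the approximation is one-sided. -/
structure Template (G : SimpleGraph V) (r t : ℕ) (I : Finset ℕ) (X : ℕ → Finset V) : Prop where
  card_eq : ∀ i ∈ I, (X i).card = t
  indep : ∀ i ∈ I, G.IsIndepSet (X i : Set V)
  near : ∀ i ∈ I, ∀ j ∈ I, i < j → ∀ x ∈ X j, (misses G x (X i)).card ≤ r

lemma Template.mono {G : SimpleGraph V} {r r' t : ℕ} {I I' : Finset ℕ} {X : ℕ → Finset V}
    (h : Template G r t I X) (hr : r ≤ r') (hI : I' ⊆ I) : Template G r' t I' X :=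
  ⟨fun i hi => h.card_eq i (hI hi), fun i hi => h.indep i (hI hi),
    fun i hi j hj hij x hx => (h.near i (hI hi) j (hI hj) hij x hx).trans hr⟩

lemma Template.snoc {G : SimpleGraph V} {r t n : ℕ} {I : Finset ℕ} {X : ℕ → Finset V}
    (h : Template G r t I X) (hn : ∀ i ∈ I, i < n) {Q : Finset V} (hQ : Q.card = t)
    (hQi : G.IsIndepSet (Q : Set V)) (hQn : ∀ i ∈ I, ∀ x ∈ Q, (misses G x (X i)).card ≤ r) :
    Template G r t (insert n I) (Function.update X n Q) := by
  have hne : ∀ i ∈ I, i ≠ n := fun i hi => (hn i hi).ne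
  refine ⟨fun i hi => ?_, fun i hi => ?_, fun i hi j hj hij x hx => ?_⟩
  · rcases Finset.mem_insert.1 hi with rfl | hi
    · simpa using hQ
    · simpa [hne i hi] using h.card_eq i hi
  · rcases Finset.mem_insert.1 hi with rfl | hi
    · simpa using hQi
    · simpa [hne i hi] using h.indep i hi
  · rcases Finset.mem_insert.1 hi with hin | hi
    · rcases Finset.mem_insert.1 hj with hjn | hj
      · omega
      · have := hn j hj; omega
    · rw [Function.update_of_ne (hne i hi)]
      rcases Finset.mem_insert.1 hj with hjn | hj
      · rw [hjn] at hx
        exact hQn i hi x (by simpa using hx)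
      · exact h.near i hi j hj hij x (by simpa [hne j hj] using hx)

lemma template_singleton {G : SimpleGraph V} {r t n : ℕ} {Q : Finset V} (hQ : Q.card = t)
    (hQi : G.IsIndepSet (Q : Set V)) : Template G r t {n} fun _ => Q :=
  ⟨fun _ _ => hQ, fun _ _ => hQi, fun i hi j hj hij => by
    simp only [Finset.mem_singleton] at hi hj; omega⟩

/-- A template contains a clique with one vertex from every part; the vertices are chosen from the
last part to the first. -/
lemma Template.exists_clique {G : SimpleGraph V} {r t k : ℕ} {I : Finset ℕ} {X : ℕ → Finset V}
    (h : Template G r t I X) (hk : I.card ≤ k) (ht : k * r < t) :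
    ∃ K ⊆ I.biUnion X, K.card = I.card ∧ G.IsClique (K : Set V) := by
  induction I using Finset.induction_on_min with
  | empty => exact ⟨∅, by simp, by simp, by simp⟩
  | insert a I ha ih =>
    have haI : a ∉ I := fun h => (ha a h).false
    rw [Finset.card_insert_of_notMem haI] at hk ⊢
    obtain ⟨K, hKs, hKc, hK⟩ := ih (h.mono le_rfl (Finset.subset_insert a I)) (by omega)
    obtain ⟨p, hp, hpK⟩ := exists_common_adj (G := G) (K := K) (X := X a) (r := r) (fun x hx => by
      obtain ⟨j, hj, hxj⟩ := Finset.mem_biUnion.1 (hKs hx)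
      exact h.near a (by simp) j (by simp [hj]) (ha j hj) x hxj) (by
      rw [h.card_eq a (by simp), hKc]
      exact lt_of_le_of_lt (Nat.mul_le_mul_right r (by omega)) ht)
    have hpK' : p ∉ K := fun h => G.irrefl (hpK p h)
    refine ⟨insert p K, ?_, by rw [Finset.card_insert_of_notMem hpK', hKc], ?_⟩
    · rw [Finset.biUnion_insert]
      exact Finset.insert_subset (Finset.mem_union_left _ hp) (hKs.trans Finset.subset_union_right)
    · rw [Finset.coe_insert, SimpleGraph.isClique_insert]
      exact ⟨hK, fun b hb _ => (hpK b (by exact_mod_cast hb)).symm⟩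

/-- If every clique of `G` has at most `τ` vertices, then some template has no successor with one
part more. The error bound grows with the number of parts, which is harmless since there are at
most `τ` of them. -/
lemma exists_maximal_template {G : SimpleGraph V} {τ s t a : ℕ} {Z : Finset V}
    (hτ : ∀ K : Finset V, G.IsClique (K : Set V) → K.card ≤ τ)
    (ht : (τ + 1) * ((τ + 1) * s) < t) (haτ : a ≤ τ + 1)
    (ha : ∃ I X, Template G (a * s) t I X ∧ I.card = a ∧ ∀ i ∈ I, X i ⊆ Z) :
    ∃ k, a ≤ k ∧ k ≤ τ ∧
      (∃ I X, Template G (k * s) t I X ∧ I.card = k ∧ ∀ i ∈ I, X i ⊆ Z) ∧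
      ¬ ∃ I X, Template G ((k + 1) * s) t I X ∧ I.card = k + 1 ∧ ∀ i ∈ I, X i ⊆ Z := by
  by_contra! hcon
  have hall : ∀ k, a ≤ k → k ≤ τ + 1 →
      ∃ I X, Template G (k * s) t I X ∧ I.card = k ∧ ∀ i ∈ I, X i ⊆ Z := by
    intro k hak
    induction k, hak using Nat.le_induction with
    | base => exact fun _ => ha
    | succ k hk ih => exact fun hkτ => hcon k hk (by omega) (ih (by omega))
  obtain ⟨I, X, hT, hI, -⟩ := hall (τ + 1) haτ le_rfl
  obtain ⟨K, -, hKc, hK⟩ := hT.exists_clique hI.le ht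
  have := hτ K hK
  omega

end Basics

/-! ### Colourings from hierarchical decompositions -/

section Peel
open Classical

variable {V : Type*}

/-- The induction behind `colBdd_of_peel`. Colours are pairs in `C × {0, …, τ * d}`, where the set
`C` of available first coordinates has as many elements as the clique bound `w`, and each vertex
comes with a set of forbidden colours whose size is controlled by the number `τ - w` of times that
the clique bound has already dropped. -/
lemma exists_list_colouring_of_peel {G : SimpleGraph V} {τ d : ℕ}
    (h : ∀ (Z : Finset V) (w : ℕ), Z.Nonempty → 2 ≤ w → w ≤ τ → CliqueBdd G Z w →
      ∃ (A B : Finset V) (a b : ℕ), A ⊆ Z ∧ B ⊆ Z ∧ (A ∪ B).Nonempty ∧ CliqueBdd G A a ∧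
        CliqueBdd G B b ∧ a < w ∧ b < w ∧ a + b ≤ w ∧
        ∀ v ∈ A ∪ B, (hits G v (Z \ (A ∪ B))).card ≤ d) (w : ℕ) (hw : w ≤ τ) (Z : Finset V)
    (hZ : CliqueBdd G Z w) (C : Finset ℕ) (hC : w ≤ C.card) (F : V → Finset (ℕ × ℕ))
    (hF : ∀ v ∈ Z, (F v).card ≤ (τ - w) * d) :
    ∃ c : V → ℕ × ℕ, (∀ v ∈ Z, (c v).1 ∈ C ∧ (c v).2 < τ * d + 1 ∧ c v ∉ F v) ∧
      ∀ u ∈ Z, ∀ v ∈ Z, G.Adj u v → c u ≠ c v := by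
  induction w using Nat.strong_induction_on generalizing Z C F with
  | _ w ihw =>
  induction Z using Finset.strongInduction with
  | H Z ihZ =>
  rcases Z.eq_empty_or_nonempty with rfl | hne
  · exact ⟨fun _ => (0, 0), by simp, by simp⟩
  have hw1 : 1 ≤ w := by
    obtain ⟨v, hv⟩ := hne
    simpa using hZ {v} (by simpa using hv) (by simp)
  rcases hw1.eq_or_lt with rfl | hw2
  · obtain ⟨a, ha⟩ := Finset.card_pos.1 (by omega : 0 < C.card)
    have hfree : ∀ v : V, ∃ k : ℕ, v ∈ Z → k < τ * d + 1 ∧ (a, k) ∉ F v := by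
      intro v
      by_cases hv : v ∈ Z
      · have hlt : (F v).card < ((Finset.range (τ * d + 1)).image fun k => (a, k)).card := by
          rw [Finset.card_image_of_injective _ (Prod.mk_right_injective a), Finset.card_range]
          exact (hF v hv).trans_lt
            (Nat.lt_succ_of_le (Nat.mul_le_mul_right d (Nat.sub_le τ 1)))
        obtain ⟨x, hx, hx'⟩ := Finset.exists_mem_notMem_of_card_lt_card hlt
        obtain ⟨k, hk, rfl⟩ := Finset.mem_image.1 hx
        exact ⟨k, fun _ => ⟨by simpa using hk, hx'⟩⟩
      · exact ⟨0, fun h => absurd h hv⟩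
    choose k hk using hfree
    refine ⟨fun v => (a, k v), fun v hv => ⟨ha, hk v hv⟩, fun u hu v hv huv => ?_⟩
    have := hZ {u, v} (Finset.insert_subset hu (by simpa using hv)) (by
      simpa [SimpleGraph.isClique_insert] using fun _ => huv)
    rw [Finset.card_pair huv.ne] at this
    omega
  obtain ⟨A, B, a, b, hA, hB, hAB, hAa, hBb, haw, hbw, hab, hd⟩ := h Z w hne hw2 hw hZ
  have hsub : Z \ (A ∪ B) ⊂ Z := Finset.sdiff_ssubset (Finset.union_subset hA hB) hAB
  obtain ⟨c₀, h₀, h₀'⟩ := ihZ _ hsub (hZ.mono hsub.subset le_rfl)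
    fun v hv => hF v (hsub.subset hv)
  obtain ⟨C₁, hC₁, hC₁c⟩ := Finset.exists_subset_card_eq (s := C) (n := a) (by omega)
  have hC₂ : b ≤ (C \ C₁).card := by
    rw [Finset.card_sdiff_of_subset hC₁]; omega
  set F' : V → Finset (ℕ × ℕ) := fun v => F v ∪ (hits G v (Z \ (A ∪ B))).image c₀ with hF'
  have hF'c : ∀ v ∈ A ∪ B, ∀ x < w, (F' v).card ≤ (τ - x) * d := by
    intro v hv x hx
    have h1 := hF v (Finset.union_subset hA hB hv)
    have h2 := Finset.card_image_le (s := hits G v (Z \ (A ∪ B))) (f := c₀)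
    have h3 := Finset.card_union_le (F v) ((hits G v (Z \ (A ∪ B))).image c₀)
    have h4 := hd v hv
    calc (F' v).card ≤ (τ - w) * d + d := by simp only [hF']; omega
      _ = (τ - w + 1) * d := by ring
      _ ≤ (τ - x) * d := Nat.mul_le_mul_right d (by omega)
  obtain ⟨c₁, h₁, h₁'⟩ := ihw a haw (by omega) A hAa C₁ hC₁c.ge F'
    fun v hv => hF'c v (Finset.mem_union_left _ hv) a haw
  obtain ⟨c₂, h₂, h₂'⟩ := ihw b hbw (by omega) B hBb (C \ C₁) hC₂ F'
    fun v hv => hF'c v (Finset.mem_union_right _ hv) b hbw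
  have hout : ∀ v ∈ Z, v ∉ A → v ∉ B → v ∈ Z \ (A ∪ B) := by
    intro v hv hvA hvB
    simp [hv, hvA, hvB]
  have hmem : ∀ u ∈ Z \ (A ∪ B), ∀ v, G.Adj v u → c₀ u ∈ F' v := fun u hu v huv =>
    Finset.mem_union_right _ (Finset.mem_image_of_mem c₀ (by simp only [mem_hits]; exact ⟨hu, huv⟩))
  have h12 : ∀ u ∈ A, ∀ v ∈ B, c₁ u ≠ c₂ v := fun u hu v hv e =>
    (Finset.mem_sdiff.1 (h₂ v hv).1).2 (e ▸ (h₁ u hu).1)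
  refine ⟨fun v => if v ∈ A then c₁ v else if v ∈ B then c₂ v else c₀ v, fun v hv => ?_,
    fun u hu v hv huv => ?_⟩
  · by_cases hvA : v ∈ A
    · simp only [hvA, if_true]
      exact ⟨hC₁ (h₁ v hvA).1, (h₁ v hvA).2.1,
        fun hc => (h₁ v hvA).2.2 (Finset.mem_union_left _ hc)⟩
    by_cases hvB : v ∈ B
    · simp only [hvA, hvB, if_true, if_false]
      exact ⟨(Finset.mem_sdiff.1 (h₂ v hvB).1).1, (h₂ v hvB).2.1,
        fun hc => (h₂ v hvB).2.2 (Finset.mem_union_left _ hc)⟩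
    · simpa only [hvA, hvB, if_false] using h₀ v (hout v hv hvA hvB)
  · by_cases huA : u ∈ A <;> by_cases hvA : v ∈ A <;> by_cases huB : u ∈ B <;>
      by_cases hvB : v ∈ B <;> simp only [huA, hvA, huB, hvB, if_true, if_false]
    all_goals first
      | exact h₁' u huA v hvA huv
      | exact h12 u huA v hvB
      | exact (h12 v hvA u huB).symm
      | exact h₂' u huB v hvB huv
      | exact h₀' u (hout u hu huA huB) v (hout v hv hvA hvB) huv
      | exact fun e => (h₁ u huA).2.2 (e ▸ hmem v (hout v hv hvA hvB) u huv)
      | exact fun e => (h₂ u huB).2.2 (e ▸ hmem v (hout v hv hvA hvB) u huv)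
      | exact fun e => (h₁ v hvA).2.2 (e ▸ hmem u (hout u hu huA huB) v huv.symm)
      | exact fun e => (h₂ v hvB).2.2 (e ▸ hmem u (hout u hu huA huB) v huv.symm)

/-- The colouring lemma for hierarchical decompositions. Suppose that from every nonempty set `Z`
one can peel off a nonempty set `A ∪ B` whose vertices have at most `d` neighbours in the rest of
`Z`, where the clique bounds of `A` and `B` are smaller than that of `Z` and sum up to at most
it. Then the chromatic number is polynomial in `τ` and `d`. -/
theorem colBdd_of_peel {G : SimpleGraph V} {τ d : ℕ}
    (h : ∀ (Z : Finset V) (w : ℕ), Z.Nonempty → 2 ≤ w → w ≤ τ → CliqueBdd G Z w →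
      ∃ (A B : Finset V) (a b : ℕ), A ⊆ Z ∧ B ⊆ Z ∧ (A ∪ B).Nonempty ∧ CliqueBdd G A a ∧
        CliqueBdd G B b ∧ a < w ∧ b < w ∧ a + b ≤ w ∧
        ∀ v ∈ A ∪ B, (hits G v (Z \ (A ∪ B))).card ≤ d) (Z : Finset V)
    (hZ : CliqueBdd G Z τ) : ColBdd G Z (τ * (τ * d + 1)) := by
  obtain ⟨c, h1, h2⟩ := exists_list_colouring_of_peel h τ le_rfl Z hZ (Finset.range τ) (by simp)
    (fun _ => ∅) (by simp)
  refine ⟨fun v => (c v).1 * (τ * d + 1) + (c v).2, fun v hv => ?_, fun u hu v hv huv e => ?_⟩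
  · have h3 := Finset.mem_range.1 (h1 v hv).1
    have h4 := (h1 v hv).2.1
    calc (c v).1 * (τ * d + 1) + (c v).2 < ((c v).1 + 1) * (τ * d + 1) := by
          rw [add_mul]; omega
      _ ≤ τ * (τ * d + 1) := Nat.mul_le_mul_right _ h3
  · have h3 := (h1 u hu).2.1
    have h4 := (h1 v hv).2.1
    refine h2 u hu v hv huv (Prod.ext ?_ ?_)
    · have := congrArg (· / (τ * d + 1)) e
      simpa [Nat.add_div_of_dvd_right, Nat.div_eq_of_lt h3, Nat.div_eq_of_lt h4] using this
    · have := congrArg (· % (τ * d + 1)) e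
      simpa [Nat.mod_eq_of_lt h3, Nat.mod_eq_of_lt h4] using this

end Peel

/-! ### Adding a disjoint star -/

section Star
open Classical

variable {V : Type*}

/-- Every set of vertices that is anticomplete to some induced star with `s` leaves is
`F`-colourable. The star has centre `c` and leaf set `S`. -/
def StarAntiBdd (G : SimpleGraph V) (s F : ℕ) : Prop :=
  ∀ (c : V) (S T : Finset V), S.card = s → G.IsIndepSet (S : Set V) → (∀ x ∈ S, G.Adj c x) →
    (∀ y ∈ T, ¬ G.Adj c y ∧ ∀ x ∈ S, ¬ G.Adj x y) → ColBdd G T F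

/-- A vertex of degree at least `R` in `Y` is the centre of a star; if there is none, then `Y` is
greedily colourable with few colours. -/
lemma exists_star {G : SimpleGraph V} {R s t : ℕ} (hR : ForcesStable G R s) {Y : Finset V}
    (hY : R * t < Y.card) (hno : ¬ ∃ S ⊆ Y, S.card = t ∧ G.IsIndepSet (S : Set V)) :
    ∃ c ∈ Y, ∃ S ∈ Y.powersetCard s, G.IsIndepSet (S : Set V) ∧ ∀ x ∈ S, G.Adj c x := by
  by_contra! hcon
  refine hno ((colBdd_of_degree (d := R) Y fun v hv => ?_).exists_stable hY)
  by_contra! hle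
  obtain ⟨S, hS, hSc, hSi⟩ := hR _ hle
  obtain ⟨x, hx, hx'⟩ := hcon v hv S
    (Finset.mem_powersetCard.2 ⟨hS.trans (hits_subset G v Y), hSc⟩) hSi
  exact hx' (mem_hits.1 (hS hx)).2

/-- The size of a set that forces a stable set of size `t` in a graph whose cliques have at most
`τ` vertices and which satisfies `StarAntiBdd G s F`. -/
def starStableBound (τ s F t : ℕ) : ℕ :=
  (τ + 1) * (((τ + 1) * (ram τ s * t + 1) + 1) +
    ((τ + 1) * (ram τ s * t + 1) + 1) * ((τ + 1) * (ram τ s * t + 1) + 1) ^ s * (F * t))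

/-- Take a set `U` of moderate size. A vertex missing many vertices of `U` is anticomplete to one
of the few stars in `U`, so there are few such vertices; the others are nearly complete to `U`.
Iterating inside the latter gives a clique with more than `τ` vertices. -/
lemma forcesStable_of_starAntiBdd {G : SimpleGraph V} {τ s F t : ℕ}
    (hτ : ∀ K : Finset V, G.IsClique (K : Set V) → K.card ≤ τ) (hF : StarAntiBdd G s F) :
    ForcesStable G (starStableBound τ s F t) t := by
  intro Z hZ
  by_contra hno
  have hno' : ∀ Y ⊆ Z, ¬ ∃ S ⊆ Y, S.card = t ∧ G.IsIndepSet (S : Set V) :=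
    fun Y hY ⟨S, hS, h⟩ => hno ⟨S, hS.trans hY, h⟩
  set q := ram τ s * t + 1 with hq
  set m := (τ + 1) * q + 1 with hm
  have key : ∀ n ≤ τ + 1, ∀ Y ⊆ Z, n * (m + m * m ^ s * (F * t)) ≤ Y.card →
      ∃ K ⊆ Y, K.card = n ∧ G.IsClique (K : Set V) := by
    intro n
    induction n with
    | zero => exact fun _ Y _ _ => ⟨∅, by simp, by simp, by simp⟩
    | succ n ih =>
      intro hn Y hYZ hY
      rw [add_mul, one_mul] at hY
      obtain ⟨U, hU, hUm⟩ := Finset.exists_subset_card_eq (s := Y) (n := m) (by omega)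
      set B := Y.filter fun x => q ≤ (misses G x U).card with hB
      have hBc : B.card ≤ m * m ^ s * (F * t) := by
        refine (card_le_of_cover (R := F * t) B (U ×ˢ U.powersetCard s)
          (fun x p => G.IsIndepSet (p.2 : Set V) ∧ p.2.card = s ∧ (∀ y ∈ p.2, G.Adj p.1 y) ∧
            ¬ G.Adj p.1 x ∧ ∀ y ∈ p.2, ¬ G.Adj y x) ?_ ?_).trans ?_
        · intro x hx
          have hx' := (Finset.mem_filter.1 hx).2
          obtain ⟨c, hc, S, hS, hSi, hcS⟩ := exists_star (forcesStable_ram hτ s) (t := t)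
            (Y := misses G x U) (by omega) (hno' _ ((misses_subset G x U).trans (hU.trans hYZ)))
          rw [Finset.mem_powersetCard] at hS
          refine ⟨(c, S), Finset.mem_product.2 ⟨misses_subset G x U hc, Finset.mem_powersetCard.2
            ⟨hS.1.trans (misses_subset G x U), hS.2⟩⟩, hSi, hS.2, hcS,
            fun h => (mem_misses.1 hc).2 h.symm, fun y hy h => (mem_misses.1 (hS.1 hy)).2 h.symm⟩
        · rintro ⟨c, S⟩ - T' hT' h'
          by_contra! hlt
          obtain ⟨x, hx⟩ := Finset.card_pos.1 ((Nat.zero_le _).trans_lt hlt)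
          obtain ⟨h1, h2, h3, -⟩ := h' x hx
          exact hno' T' (hT'.trans ((Finset.filter_subset _ _).trans hYZ))
            ((hF c S T' h2 h1 h3 fun y hy => (h' y hy).2.2.2).exists_stable hlt)
        · rw [Finset.card_product, hUm]
          have := card_powersetCard_le U s
          rw [hUm] at this
          gcongr
      obtain ⟨K, hK, hKc, hKq⟩ := ih (by omega) (Y \ (U ∪ B))
        (Finset.sdiff_subset.trans hYZ) (by
          have h1 := Finset.le_card_sdiff (U ∪ B) Y
          have h2 := Finset.card_union_le U B
          omega)
      obtain ⟨p, hp, hpK⟩ := exists_common_adj (G := G) (K := K) (X := U) (r := q) (fun x hx => by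
          have hx' := Finset.mem_sdiff.1 (hK hx)
          by_contra! hlt
          exact hx'.2 (Finset.mem_union_right _ (Finset.mem_filter.2 ⟨hx'.1, hlt.le⟩))) (by
          rw [hKc, hUm, hm]
          exact Nat.lt_succ_of_le (Nat.mul_le_mul_right q (by omega)))
      have hpK' : p ∉ K := fun h => G.irrefl (hpK p h)
      refine ⟨insert p K, Finset.insert_subset (hU hp) (hK.trans Finset.sdiff_subset),
        by rw [Finset.card_insert_of_notMem hpK', hKc], ?_⟩
      rw [Finset.coe_insert, SimpleGraph.isClique_insert]
      exact ⟨hKq, fun b hb _ => (hpK b (by exact_mod_cast hb)).symm⟩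
  obtain ⟨K, -, hKc, hK⟩ := key (τ + 1) le_rfl Z subset_rfl hZ
  have := hτ K hK
  omega

/-- If `Z` contains no two-part template, then the chromatic number of `Z` drops only by a bounded
amount on passing to the neighbours of a suitable vertex `v`: for a stable set `P` of neighbours of
`v`, a non-neighbour of `v` either misses `s` vertices of `P`, and is then anticomplete to a star
with centre `v`, or is one of the few vertices that are nearly complete to `P`. -/
lemma colBdd_of_no_pair {G : SimpleGraph V} {s F t N : ℕ} (hF : StarAntiBdd G s F)
    (hN : ForcesStable G N t) (w : ℕ) (Z : Finset V) (hZ : CliqueBdd G Z w)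
    (hno : ¬ ∃ P ⊆ Z, ∃ Q ⊆ Z, (P.card = t ∧ G.IsIndepSet (P : Set V)) ∧
      (Q.card = t ∧ G.IsIndepSet (Q : Set V)) ∧ ∀ x ∈ Q, (misses G x P).card ≤ s) :
    ColBdd G Z (w * (N + t ^ s * F) + N) := by
  induction w generalizing Z with
  | zero =>
    have : Z = ∅ := Finset.eq_empty_of_forall_notMem fun v hv => by
      have := hZ {v} (by simpa using hv) (by simp)
      simp at this
    rw [this]
    exact colBdd_empty G _
  | succ w ih =>
    by_cases hdeg : ∀ v ∈ Z, (hits G v Z).card < N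
    · exact (colBdd_of_degree Z hdeg).mono subset_rfl (Nat.le_add_left _ _)
    push Not at hdeg
    obtain ⟨v, hv, hvN⟩ := hdeg
    obtain ⟨P, hP, hPc, hPi⟩ := hN _ hvN
    have h1 : ColBdd G (hits G v Z) (w * (N + t ^ s * F) + N) := by
      refine ih _ (fun K hK hKc => ?_) fun ⟨P, hP, Q, hQ, h⟩ =>
        hno ⟨P, hP.trans (hits_subset G v Z), Q, hQ.trans (hits_subset G v Z), h⟩
      have hvK : v ∉ K := fun h => G.irrefl (mem_hits.1 (hK h)).2
      have := hZ (insert v K) (Finset.insert_subset hv (hK.trans (hits_subset G v Z))) (by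
        rw [Finset.coe_insert, SimpleGraph.isClique_insert]
        exact ⟨hKc, fun b hb _ => (mem_hits.1 (hK (by exact_mod_cast hb))).2⟩)
      rw [Finset.card_insert_of_notMem hvK] at this
      omega
    set W := Z.filter fun x => (misses G x P).card ≤ s with hW
    have hWc : W.card ≤ N := by
      by_contra! hlt
      obtain ⟨Q, hQ, hQc, hQi⟩ := hN _ hlt.le
      exact hno ⟨P, hP.trans (hits_subset G v Z), Q, hQ.trans (Finset.filter_subset _ _),
        ⟨hPc, hPi⟩, ⟨hQc, hQi⟩, fun x hx => (Finset.mem_filter.1 (hQ hx)).2⟩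
    have h2 : ColBdd G W N := (colBdd_card G W).mono subset_rfl hWc
    have h3 := ColBdd.biUnion (G := G) (n := F) (P.powersetCard s)
      (fun S => Z.filter fun x => ¬ G.Adj v x ∧ ∀ y ∈ S, ¬ G.Adj y x) fun S hS => by
        rw [Finset.mem_powersetCard] at hS
        exact hF v S _ hS.2 (isIndepSet_mono hPi hS.1)
          (fun x hx => (mem_hits.1 (hP (hS.1 hx))).2) fun y hy => (Finset.mem_filter.1 hy).2
    have hpow := card_powersetCard_le P s
    rw [hPc] at hpow
    refine ((h1.union h2).union (h3.mono subset_rfl (Nat.mul_le_mul_right F hpow))).mono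
      (fun x hx => ?_) (by rw [add_mul]; omega)
    by_cases hvx : G.Adj v x
    · exact Finset.mem_union_left _ (Finset.mem_union_left _ (mem_hits.2 ⟨hx, hvx⟩))
    by_cases hxs : (misses G x P).card ≤ s
    · exact Finset.mem_union_left _ (Finset.mem_union_right _ (Finset.mem_filter.2 ⟨hx, hxs⟩))
    obtain ⟨S, hS, hSc⟩ := Finset.exists_subset_card_eq (le_of_not_ge hxs)
    refine Finset.mem_union_right _ (Finset.mem_biUnion.2 ⟨S, Finset.mem_powersetCard.2
      ⟨hS.trans (misses_subset G x P), hSc⟩, Finset.mem_filter.2 ⟨hx, hvx, fun y hy h =>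
      (mem_misses.1 (hS hy)).2 h.symm⟩⟩)

/-- The size of the parts of the templates used for adding a star. -/
def starPart (τ s : ℕ) : ℕ := (τ + 1) * ((τ + 1) * s) + 1

/-- The number of colours for a graph whose cliques have at most `τ` vertices and which satisfies
`StarAntiBdd G s F`. -/
def starColours (τ s F : ℕ) : ℕ :=
  (τ * starPart τ s) * (τ * starPart τ s) ^ s * F + starStableBound τ s F (starPart τ s) +
    τ * (τ * (starStableBound τ s F (starPart τ s) + starPart τ s ^ s * F) +
      starStableBound τ s F (starPart τ s))

/-- Take a template that cannot be extended. A vertex that is not anticomplete to a star inside the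
template fails to be nearly complete to at most one part `X j`. The vertices nearly complete to all
parts are few; the vertices nearly complete to all parts except `X j` contain no two-part template,
as it could replace `X j`. -/
theorem colBdd_of_starAntiBdd {G : SimpleGraph V} {τ s F : ℕ}
    (hτ : ∀ K : Finset V, G.IsClique (K : Set V) → K.card ≤ τ) (hF : StarAntiBdd G s F)
    (Z : Finset V) : ColBdd G Z (starColours τ s F) := by
  set t := starPart τ s with ht
  set N := starStableBound τ s F t with hN
  have hNt : ForcesStable G N t := forcesStable_of_starAntiBdd hτ hF
  by_cases hZN : Z.card < N
  · exact (colBdd_card G Z).mono subset_rfl (by unfold starColours; rw [← ht, ← hN]; omega)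
  have hτ1 : 1 ≤ τ + 1 := by omega
  obtain ⟨k, hk1, hkτ, ⟨I, X, hT, hIk, hXZ⟩, hmax⟩ := exists_maximal_template (Z := Z) (s := s)
    (t := t) (a := 1) hτ (by rw [ht, starPart]; omega) hτ1 (by
      obtain ⟨Q, hQ, hQc, hQi⟩ := hNt Z (by omega)
      exact ⟨{0}, fun _ => Q, template_singleton hQc hQi, by simp, fun _ _ => hQ⟩)
  set n := I.sup id + 1 with hn
  have hIn : ∀ i ∈ I, i < n := fun i hi => Nat.lt_succ_of_le (Finset.le_sup (f := id) hi)
  set U := I.biUnion X with hU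
  have hUc : U.card ≤ τ * t :=
    (Finset.card_biUnion_le_card_mul I X t fun i hi => (hT.card_eq i hi).le).trans
      (Nat.mul_le_mul_right t (hIk.le.trans hkτ))
  have hXU : ∀ i ∈ I, X i ⊆ U := fun i hi => Finset.subset_biUnion_of_mem X hi
  have hks : (k + 1) * s = k * s + s := by ring
  have hle : k * s ≤ (k + 1) * s := by omega
  -- the vertices anticomplete to a star inside the template
  set Q := (U ×ˢ U.powersetCard s).filter fun p : V × Finset V =>
    G.IsIndepSet (p.2 : Set V) ∧ ∀ x ∈ p.2, G.Adj p.1 x with hQ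
  set E := Q.biUnion fun p => Z.filter fun x => ¬ G.Adj p.1 x ∧ ∀ y ∈ p.2, ¬ G.Adj y x with hE
  have hEcol : ColBdd G E ((τ * t) * (τ * t) ^ s * F) := by
    have := ColBdd.biUnion (G := G) (n := F) Q
      (fun p => Z.filter fun x => ¬ G.Adj p.1 x ∧ ∀ y ∈ p.2, ¬ G.Adj y x) fun p hp => by
        have hp' := Finset.mem_filter.1 hp
        exact hF p.1 p.2 _ (Finset.mem_powersetCard.1 (Finset.mem_product.1 hp'.1).2).2 hp'.2.1
          hp'.2.2 fun y hy => (Finset.mem_filter.1 hy).2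
    refine this.mono subset_rfl (Nat.mul_le_mul_right F ?_)
    refine (Finset.card_filter_le _ _).trans ?_
    rw [Finset.card_product]
    exact Nat.mul_le_mul hUc ((card_powersetCard_le U s).trans (Nat.pow_le_pow_left hUc s))
  have hmiss : ∀ x ∈ Z, x ∉ E → ∀ i ∈ I, ∀ j ∈ I, i < j → ∀ v ∈ X j, ¬ G.Adj x v →
      (misses G x (X i)).card ≤ (k + 1) * s := by
    intro x hxZ hxE i hi j hj hij v hv hxv
    by_contra! hlt
    have h1 := hT.near i hi j hj hij v hv
    have h2 := Finset.le_card_sdiff (misses G v (X i)) (misses G x (X i))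
    obtain ⟨S, hS, hSc⟩ := Finset.exists_subset_card_eq
      (s := misses G x (X i) \ misses G v (X i)) (n := s) (by omega)
    have hSx : ∀ y ∈ S, y ∈ X i ∧ ¬ G.Adj x y ∧ G.Adj v y := fun y hy => by
      have := hS hy
      simp only [Finset.mem_sdiff, mem_misses, not_and, not_not] at this
      exact ⟨this.1.1, this.1.2, this.2 this.1.1⟩
    refine hxE (Finset.mem_biUnion.2 ⟨(v, S), Finset.mem_filter.2 ⟨Finset.mem_product.2
      ⟨hXU j hj hv, Finset.mem_powersetCard.2 ⟨fun y hy => hXU i hi (hSx y hy).1, hSc⟩⟩,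
      isIndepSet_mono (hT.indep i hi) fun y hy => (hSx y hy).1, fun y hy => (hSx y hy).2.2⟩,
      Finset.mem_filter.2 ⟨hxZ, fun h => hxv h.symm, fun y hy h => (hSx y hy).2.1 h.symm⟩⟩)
  set A := Z.filter fun x => ∀ i ∈ I, (misses G x (X i)).card ≤ (k + 1) * s with hA
  have hAcol : ColBdd G A N := by
    refine (colBdd_card G A).mono subset_rfl ?_
    by_contra! hlt
    obtain ⟨P, hP, hPc, hPi⟩ := hNt A hlt.le
    refine hmax ⟨insert n I, Function.update X n P, (hT.mono hle subset_rfl).snoc hIn hPc hPi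
      fun i hi x hx => (Finset.mem_filter.1 (hP hx)).2 i hi, ?_, fun i hi => ?_⟩
    · rw [Finset.card_insert_of_notMem fun h => (hIn n h).false, hIk]
    · rcases Finset.mem_insert.1 hi with rfl | hi
      · simpa using hP.trans (Finset.filter_subset _ _)
      · simpa [(hIn i hi).ne] using hXZ i hi
  have hBcol := ColBdd.biUnion (G := G) (n := τ * (N + t ^ s * F) + N) I
    (fun j => Z.filter fun x => ∀ i ∈ I.erase j, (misses G x (X i)).card ≤ (k + 1) * s)
    fun j hj => by
      refine colBdd_of_no_pair hF hNt τ _ (fun K _ hK => hτ K hK) ?_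
      rintro ⟨P, hP, P', hP', ⟨hPc, hPi⟩, ⟨hPc', hPi'⟩, hPP'⟩
      have hlt : ∀ i ∈ I.erase j, i < n := fun i hi => hIn i (Finset.mem_of_mem_erase hi)
      have hT1 := (hT.mono hle (Finset.erase_subset j I)).snoc hlt hPc hPi
        fun i hi x hx => (Finset.mem_filter.1 (hP hx)).2 i hi
      have hlt' : ∀ i ∈ insert n (I.erase j), i < n + 1 := fun i hi => by
        rcases Finset.mem_insert.1 hi with rfl | hi
        · omega
        · have := hlt i hi; omega
      have hT2 := hT1.snoc hlt' hPc' hPi' fun i hi x hx => by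
        rcases Finset.mem_insert.1 hi with rfl | hi
        · rw [Function.update_self]
          exact (hPP' x hx).trans (Nat.le_mul_of_pos_left s (by omega))
        · rw [Function.update_of_ne (hlt i hi).ne]
          exact (Finset.mem_filter.1 (hP' hx)).2 i hi
      refine hmax ⟨_, _, hT2, ?_, fun i hi => ?_⟩
      · rw [Finset.card_insert_of_notMem fun h => (hlt' _ h).false,
          Finset.card_insert_of_notMem fun h => (hlt _ h).false, Finset.card_erase_of_mem hj]
        omega
      · rcases Finset.mem_insert.1 hi with rfl | hi
        · simpa using hP'.trans (Finset.filter_subset _ _)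
        rw [Function.update_of_ne (hlt' i hi).ne]
        rcases Finset.mem_insert.1 hi with rfl | hi
        · simpa using hP.trans (Finset.filter_subset _ _)
        · rw [Function.update_of_ne (hlt i hi).ne]
          exact hXZ i (Finset.mem_of_mem_erase hi)
  refine ((hEcol.union hAcol).union (hBcol.mono subset_rfl
    (Nat.mul_le_mul_right _ (hIk.le.trans hkτ)))).mono (fun x hx => ?_) le_rfl
  by_cases hxE : x ∈ E
  · exact Finset.mem_union_left _ (Finset.mem_union_left _ hxE)
  by_cases hxA : ∀ i ∈ I, (misses G x (X i)).card ≤ (k + 1) * s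
  · exact Finset.mem_union_left _ (Finset.mem_union_right _ (Finset.mem_filter.2 ⟨hx, hxA⟩))
  push Not at hxA
  obtain ⟨j, hj, hlt⟩ := hxA
  refine Finset.mem_union_right _ (Finset.mem_biUnion.2 ⟨j, hj, Finset.mem_filter.2
    ⟨hx, fun i hi => ?_⟩⟩)
  obtain ⟨hij, hi⟩ := Finset.mem_erase.1 hi
  rcases lt_or_gt_of_ne hij with h | h
  · obtain ⟨v, hv⟩ := Finset.card_pos.1 ((Nat.zero_le _).trans_lt hlt)
    rw [mem_misses] at hv
    exact hmiss x hx hxE i hi j hj h v hv.1 hv.2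
  · -- a missed vertex of the later part `X i` would force `x` to be nearly complete to `X j`
    by_contra! hlt'
    obtain ⟨v, hv⟩ := Finset.card_pos.1 ((Nat.zero_le _).trans_lt hlt')
    rw [mem_misses] at hv
    exact hlt.not_ge (hmiss x hx hxE j hj i hi h v hv.1 hv.2)

end Star

/-! ### Large stable sets in graphs without a double star -/

section StableSets
open Classical

variable {V : Type*}

/-- A quantitative form of excluding the double star with `s` leaves at either end: if the adjacent
vertices `u` and `v` are its internal vertices and `S` is the set of leaves at `u`, then fewer than
`R` vertices qualify as leaves at `v`. -/
def DoubleStarBdd (G : SimpleGraph V) (s R : ℕ) : Prop :=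
  ∀ (u v : V) (S T : Finset V), G.Adj u v → S.card = s → G.IsIndepSet (S : Set V) →
    (∀ x ∈ S, G.Adj u x ∧ ¬ G.Adj v x) →
    (∀ y ∈ T, G.Adj v y ∧ ¬ G.Adj u y ∧ ∀ x ∈ S, ¬ G.Adj x y) → T.card < R

/-- The vertices `a`, `b`, `c`, `d` form an induced four-vertex path, in this order. -/
def IsPathFour (G : SimpleGraph V) (a b c d : V) : Prop :=
  G.Adj a b ∧ G.Adj b c ∧ G.Adj c d ∧ ¬ G.Adj a c ∧ ¬ G.Adj a d ∧ ¬ G.Adj b d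

/-- Among the vertices of the stable set `I`, one with the most neighbours in the clique `K` is
complete to `K`: otherwise a neighbour in `I` of a missed vertex of `K` completes a four-vertex
path. -/
lemma exists_complete_of_no_pathFour {G : SimpleGraph V} {I K : Finset V} (hI : I.Nonempty)
    (hIi : G.IsIndepSet (I : Set V)) (hK : G.IsClique (K : Set V))
    (hIK : ∀ k ∈ K, ∃ y ∈ I, G.Adj y k)
    (hP : ∀ y ∈ I, ∀ k ∈ K, ∀ k' ∈ K, ∀ x ∈ I, ¬ IsPathFour G y k k' x) :
    ∃ x ∈ I, ∀ k ∈ K, G.Adj x k := by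
  obtain ⟨x, hx, hmax⟩ := Finset.exists_max_image I (fun x => (hits G x K).card) hI
  refine ⟨x, hx, fun k hk => ?_⟩
  by_contra hxk
  obtain ⟨y, hy, hyk⟩ := hIK k hk
  have hnot : ¬ hits G x K ⊆ hits G y K := fun hsub => by
    have hlt : (hits G x K).card < (hits G y K).card := Finset.card_lt_card
      ⟨hsub, fun h => hxk (mem_hits.1 (h (mem_hits.2 ⟨hk, hyk⟩))).2⟩
    exact (hmax y hy).not_gt hlt
  obtain ⟨k', hk', hk'y⟩ := Finset.not_subset.1 hnot
  rw [mem_hits] at hk' hk'y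
  have hkk' : k ≠ k' := fun e => hxk (e ▸ hk'.2)
  exact hP y hy k hk k' hk'.1 x hx ⟨hyk,
    hK (by exact_mod_cast hk) (by exact_mod_cast hk'.1) hkk', hk'.2.symm,
    fun h => hk'y ⟨hk'.1, h⟩, not_adj_of_isIndepSet hIi hy hx, fun h => hxk h.symm⟩

/-- A graph without induced four-vertex paths is covered by as many stable sets as some clique has
vertices. Stated for a set `Y` without stable sets of size `t`. -/
lemma exists_clique_of_no_pathFour {G : SimpleGraph V} {t : ℕ} (Y : Finset V)
    (hP : ∀ a ∈ Y, ∀ b ∈ Y, ∀ c ∈ Y, ∀ d ∈ Y, ¬ IsPathFour G a b c d)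
    (hno : ¬ ∃ S ⊆ Y, S.card = t ∧ G.IsIndepSet (S : Set V)) :
    ∃ K ⊆ Y, G.IsClique (K : Set V) ∧ Y.card ≤ K.card * t := by
  induction Y using Finset.strongInduction with
  | H Y ih =>
  rcases Y.eq_empty_or_nonempty with rfl | ⟨v, hv⟩
  · exact ⟨∅, by simp, by simp, by simp⟩
  obtain ⟨I, hI, hmax⟩ := Finset.exists_max_image
    (Y.powerset.filter fun I : Finset V => G.IsIndepSet (I : Set V)) Finset.card
    ⟨∅, by simp⟩
  simp only [Finset.mem_filter, Finset.mem_powerset] at hI hmax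
  have hIne : I.Nonempty := by
    rw [← Finset.card_pos]
    have := hmax {v} ⟨by simpa using hv, by simp⟩
    simpa using this
  have hIt : I.card ≤ t := by
    by_contra! hlt
    obtain ⟨S, hS, hSc⟩ := Finset.exists_subset_card_eq hlt.le
    exact hno ⟨S, hS.trans hI.1, hSc, isIndepSet_mono hI.2 hS⟩
  obtain ⟨K, hK, hKc, hKt⟩ := ih (Y \ I) (Finset.sdiff_ssubset hI.1 hIne)
    (fun a ha b hb c hc d hd => hP a (Finset.sdiff_subset ha) b (Finset.sdiff_subset hb) c
      (Finset.sdiff_subset hc) d (Finset.sdiff_subset hd))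
    fun ⟨S, hS, h⟩ => hno ⟨S, hS.trans Finset.sdiff_subset, h⟩
  obtain ⟨x, hx, hxK⟩ := exists_complete_of_no_pathFour hIne hI.2 hKc (fun k hk => by
      obtain ⟨hkY, hkI⟩ := Finset.mem_sdiff.1 (hK hk)
      by_contra! hcon
      have := hmax (insert k I) ⟨Finset.insert_subset hkY hI.1, by
        rw [Finset.coe_insert]
        exact Set.pairwise_insert.2 ⟨hI.2, fun b hb _ => ⟨fun h => hcon b hb h.symm,
          hcon b hb⟩⟩⟩
      rw [Finset.card_insert_of_notMem hkI] at this
      omega)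
    fun y hy k hk k' hk' x hx => hP y (hI.1 hy) k (Finset.sdiff_subset (hK hk)) k'
      (Finset.sdiff_subset (hK hk')) x (hI.1 hx)
  have hxK' : x ∉ K := fun h => (Finset.mem_sdiff.1 (hK h)).2 hx
  refine ⟨insert x K, Finset.insert_subset (hI.1 hx) (hK.trans Finset.sdiff_subset), ?_, ?_⟩
  · rw [Finset.coe_insert, SimpleGraph.isClique_insert]
    exact ⟨hKc, fun b hb _ => hxK b (by exact_mod_cast hb)⟩
  · rw [Finset.card_insert_of_notMem hxK', add_mul, one_mul]
    have := Finset.card_sdiff_add_card_eq_card hI.1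
    omega

lemma choose_mul_pow_four_le (n k : ℕ) :
    n.choose k * (n - (k + 4)) ^ 4 ≤ n.choose (k + 4) * (k + 4) ^ 4 := by
  have step : ∀ j < k + 4, n.choose j * (n - (k + 4)) ≤ n.choose (j + 1) * (k + 4) := by
    intro j hj
    calc n.choose j * (n - (k + 4)) ≤ n.choose j * (n - j) :=
          Nat.mul_le_mul_left _ (by omega)
      _ = n.choose (j + 1) * (j + 1) := (Nat.choose_succ_right_eq n j).symm
      _ ≤ n.choose (j + 1) * (k + 4) := Nat.mul_le_mul_left _ (by omega)
  set p := n - (k + 4)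
  set q := k + 4 with hq
  calc n.choose k * p ^ 4 = (n.choose k * p) * p ^ 3 := by ring
    _ ≤ (n.choose (k + 1) * q) * p ^ 3 := Nat.mul_le_mul_right _ (step k (by omega))
    _ = (n.choose (k + 1) * p) * (p ^ 2 * q) := by ring
    _ ≤ (n.choose (k + 1 + 1) * q) * (p ^ 2 * q) :=
        Nat.mul_le_mul_right _ (step (k + 1) (by omega))
    _ = (n.choose (k + 2) * p) * (p * q ^ 2) := by ring
    _ ≤ (n.choose (k + 2 + 1) * q) * (p * q ^ 2) :=
        Nat.mul_le_mul_right _ (step (k + 2) (by omega))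
    _ = (n.choose (k + 3) * p) * q ^ 3 := by ring
    _ ≤ (n.choose (k + 3 + 1) * q) * q ^ 3 := Nat.mul_le_mul_right _ (step (k + 3) (by omega))
    _ = n.choose (k + 4) * q ^ 4 := by ring

/-- If every set of `m` vertices of `Z` contains an induced four-vertex path, then counting the
pairs of an `m`-set and a path in it shows that there are many such paths in `Z`. A path
`a`, `b`, `c`, `d` is recorded as `((b, c), (a, d))`. -/
lemma card_pathFour_ge {G : SimpleGraph V} {m : ℕ} {Z : Finset V} (hmZ : m ≤ Z.card)
    (hP : ∀ Y ⊆ Z, Y.card = m → ∃ a ∈ Y, ∃ b ∈ Y, ∃ c ∈ Y, ∃ d ∈ Y, IsPathFour G a b c d) :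
    (Z.card - m) ^ 4 ≤ m ^ 4 * (((Z ×ˢ Z) ×ˢ (Z ×ˢ Z)).filter fun p =>
      IsPathFour G p.2.1 p.1.1 p.1.2 p.2.2).card := by
  have hdist : ∀ a b c d, IsPathFour G a b c d → ({a, b, c, d} : Finset V).card = 4 := by
    rintro a b c d ⟨hab, hbc, hcd, hac, had, hbd⟩
    have h1 : a ≠ c := fun e => had (e ▸ hcd)
    have h2 : a ≠ d := fun e => hbd (e ▸ hab.symm)
    have h3 : b ≠ d := fun e => had (e ▸ hab)
    rw [Finset.card_insert_of_notMem (by simp [hab.ne, h1, h2]),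
      Finset.card_insert_of_notMem (by simp [hbc.ne, h3]), Finset.card_pair hcd.ne]
  have hm4 : 4 ≤ m := by
    obtain ⟨Y, hY, hYc⟩ := Finset.exists_subset_card_eq hmZ
    obtain ⟨a, ha, b, hb, c, hc, d, hd, hp⟩ := hP Y hY hYc
    rw [← hdist a b c d hp, ← hYc]
    exact Finset.card_le_card (by simp [Finset.insert_subset_iff, ha, hb, hc, hd])
  obtain ⟨k, rfl⟩ := Nat.exists_eq_add_of_le' hm4
  set P := ((Z ×ˢ Z) ×ˢ (Z ×ˢ Z)).filter fun p => IsPathFour G p.2.1 p.1.1 p.1.2 p.2.2 with hPd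
  have hcount : Z.card.choose (k + 4) ≤ P.card * Z.card.choose k := by
    rw [← Finset.card_powersetCard]
    refine card_le_of_cover _ P (fun Y p => ({p.2.1, p.1.1, p.1.2, p.2.2} : Finset V) ⊆ Y) ?_ ?_
    · intro Y hY
      rw [Finset.mem_powersetCard] at hY
      obtain ⟨a, ha, b, hb, c, hc, d, hd, hp⟩ := hP Y hY.1 hY.2
      exact ⟨((b, c), (a, d)), Finset.mem_filter.2 ⟨by
        simp [hY.1 ha, hY.1 hb, hY.1 hc, hY.1 hd], hp⟩, by
        simp [Finset.insert_subset_iff, ha, hb, hc, hd]⟩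
    · intro p hp T' hT' hsub
      have hc4 := hdist _ _ _ _ (Finset.mem_filter.1 hp).2
      set q := ({p.2.1, p.1.1, p.1.2, p.2.2} : Finset V) with hq
      rw [← Finset.card_powersetCard]
      refine Finset.card_le_card_of_injOn (fun Y => Y \ q) (fun Y hY => ?_)
        fun Y hY Y' hY' e => ?_
      · have hY' := Finset.mem_powersetCard.1 (hT' hY)
        refine Finset.mem_coe.2 (Finset.mem_powersetCard.2
          ⟨Finset.sdiff_subset.trans hY'.1, ?_⟩)
        rw [Finset.card_sdiff_of_subset (hsub Y hY), hY'.2, hc4]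
        omega
      · rw [← Finset.sdiff_union_of_subset (hsub Y hY), ← Finset.sdiff_union_of_subset
          (hsub Y' hY')]
        simp only at e
        rw [e]
  have hpos : 0 < Z.card.choose k := Nat.choose_pos (by omega)
  refine Nat.le_of_mul_le_mul_left ?_ hpos
  calc Z.card.choose k * (Z.card - (k + 4)) ^ 4 ≤ Z.card.choose (k + 4) * (k + 4) ^ 4 :=
        choose_mul_pow_four_le _ _
    _ ≤ P.card * Z.card.choose k * (k + 4) ^ 4 := Nat.mul_le_mul_right _ hcount
    _ = _ := by ring

lemma exists_large_fiber {α β : Type*} {s : Finset α} {t : Finset β} (f : α → β)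
    (hf : ∀ a ∈ s, f a ∈ t) (ht : t.Nonempty) {A L : ℕ} (h : t.card * A ≤ L * s.card) :
    ∃ y ∈ t, A ≤ L * (s.filter fun a => f a = y).card := by
  by_contra! hcon
  have h1 := Finset.sum_lt_sum_of_nonempty ht hcon
  rw [← Finset.mul_sum, ← Finset.card_eq_sum_card_fiberwise hf, Finset.sum_const,
    smul_eq_mul] at h1
  omega

/-- Counting related pairs, the elements of `B` with fewer than `θ` relatives in `A` contribute
little. -/
lemma sum_card_le_heavy {α β : Type*} (A : Finset α) (B : Finset β) (rel : α → β → Prop) (θ : ℕ) :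
    ∑ b ∈ B, (A.filter fun a => rel a b).card ≤
      (B.filter fun b => θ ≤ (A.filter fun a => rel a b).card).card * A.card + B.card * θ := by
  rw [← Finset.sum_filter_add_sum_filter_not B fun b => θ ≤ (A.filter fun a => rel a b).card]
  refine Nat.add_le_add ?_ ?_
  · exact Finset.sum_le_card_nsmul _ _ _ fun b _ => Finset.card_filter_le _ _
  · refine (Finset.sum_le_card_nsmul _ _ θ fun b hb => ?_).trans
      (Nat.mul_le_mul_right θ (Finset.card_filter_le _ _))
    exact (not_le.1 (Finset.mem_filter.1 hb).2).le

/-- The size of a set that forces a stable set of size `t` in a graph whose cliques have at most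
`τ` vertices and which satisfies `DoubleStarBdd G s R`. -/
def doubleStarStableBound (τ s R t : ℕ) : ℕ :=
  2 * (16 * (τ * t + 1) ^ 4) *
    (2 * (4 * (16 * (τ * t + 1) ^ 4) * R) ^ s * R + 4 * (16 * (τ * t + 1) ^ 4) * R +
      (τ * t + 1))

/-- If there is no stable set of size `t`, then every set of `τ * t + 1` vertices contains an
induced four-vertex path, so some edge `b c` is the middle edge of very many paths
`a`, `b`, `c`, `d`. The pairs `(a, d)` are so dense that a stable set of `s` vertices `d` has many
common partners `a`; this is a double star. -/
lemma forcesStable_of_doubleStarBdd {G : SimpleGraph V} {τ s R t : ℕ}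
    (hτ : ∀ K : Finset V, G.IsClique (K : Set V) → K.card ≤ τ) (hRs : ForcesStable G R s)
    (hs : 0 < s) (hR : 0 < R) (hD : DoubleStarBdd G s R) :
    ForcesStable G (doubleStarStableBound τ s R t) t := by
  intro Z₀ hZ₀
  by_contra hno₀
  set m := τ * t + 1 with hm
  set L := 16 * m ^ 4 with hL
  set M := 4 * L * R with hM
  set ν := 2 * M ^ s * R + M + m with hν
  have hbound : doubleStarStableBound τ s R t = 2 * L * ν := rfl
  obtain ⟨Z, hZ, hZc⟩ := Finset.exists_subset_card_eq (hbound ▸ hZ₀)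
  have hno : ∀ Y ⊆ Z, ¬ ∃ S ⊆ Y, S.card = t ∧ G.IsIndepSet (S : Set V) :=
    fun Y hY ⟨S, hS, h⟩ => hno₀ ⟨S, (hS.trans hY).trans hZ, h⟩
  have hLpos : 0 < L := by positivity
  have hMpos : 0 < M := by positivity
  have hmν : m ≤ ν := Nat.le_add_left _ _
  have h2m : 2 * m ≤ Z.card := by
    rw [hZc, mul_assoc]
    exact Nat.mul_le_mul_left 2 (hmν.trans (Nat.le_mul_of_pos_left ν hLpos))
  have hcount := card_pathFour_ge (G := G) (m := m) (Z := Z) (by omega) (by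
    intro Y hY hYc
    by_contra! hcon
    obtain ⟨K, -, hK, hKt⟩ := exists_clique_of_no_pathFour Y hcon (hno Y hY)
    have := Nat.mul_le_mul_right t (hτ K hK)
    omega)
  set P := ((Z ×ˢ Z) ×ˢ (Z ×ˢ Z)).filter fun p => IsPathFour G p.2.1 p.1.1 p.1.2 p.2.2 with hPd
  set n := Z.card with hn
  have hn0 : 0 < n := by omega
  have hPn : n ^ 4 ≤ L * P.card := by
    calc n ^ 4 ≤ (2 * (n - m)) ^ 4 := Nat.pow_le_pow_left (by omega) 4
      _ = 16 * (n - m) ^ 4 := by ring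
      _ ≤ 16 * (m ^ 4 * P.card) := Nat.mul_le_mul_left 16 hcount
      _ = L * P.card := by rw [hL]; ring
  obtain ⟨z, hz⟩ := Finset.card_pos.1 hn0
  obtain ⟨⟨b, c⟩, -, hbc⟩ := exists_large_fiber (s := P) (t := Z ×ˢ Z) (A := n ^ 2) (L := L)
    Prod.fst (fun p hp => (Finset.mem_product.1 (Finset.mem_filter.1 hp).1).1)
    ⟨(z, z), by simp [hz]⟩ (by rw [Finset.card_product]; linarith [pow_add n 2 2, hPn])
  replace hbc : n ^ 2 ≤ L * (P.filter fun p => p.1 = (b, c)).card := by convert hbc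
  set rel : V → V → Prop := fun a d => IsPathFour G a b c d with hrel
  have hfib : (P.filter fun p => p.1 = (b, c)).card ≤
      ∑ d ∈ Z, (Z.filter fun a => rel a d).card := by
    rw [← Finset.card_sigma]
    refine Finset.card_le_card_of_injOn (fun p => ⟨p.2.2, p.2.1⟩) (fun p hp => ?_)
      fun p hp p' hp' e => ?_
    · have hp := Finset.mem_coe.1 hp
      rw [Finset.mem_filter, hPd, Finset.mem_filter] at hp
      obtain ⟨⟨h1, h2⟩, h3⟩ := hp
      rw [h3] at h2
      simp only [Finset.mem_product] at h1
      simp only [Finset.coe_sigma, Set.mem_sigma_iff, Finset.mem_coe, Finset.mem_filter]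
      exact ⟨h1.2.2, h1.2.1, h2⟩
    · have h1 := (Finset.mem_filter.1 (Finset.mem_coe.1 hp)).2
      have h2 := (Finset.mem_filter.1 (Finset.mem_coe.1 hp')).2
      simp only [Sigma.mk.injEq, heq_eq_eq] at e
      exact Prod.ext (h1.trans h2.symm) (Prod.ext e.2 e.1)
  -- many vertices `d` have at least `ν` partners `a`
  set D := Z.filter fun d => ν ≤ (Z.filter fun a => rel a d).card with hDd
  have hDc : ν ≤ D.card := by
    have h1 := sum_card_le_heavy Z Z rel ν
    rw [← hDd, ← hn] at h1
    have h2 : n ^ 2 ≤ L * (D.card * n + n * ν) := hbc.trans (Nat.mul_le_mul_left L (hfib.trans h1))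
    have h3 : n * n ≤ n * (L * D.card + L * ν) := by
      calc n * n = n ^ 2 := by ring
        _ ≤ L * (D.card * n + n * ν) := h2
        _ = _ := by ring
    have h4 := Nat.le_of_mul_le_mul_left h3 hn0
    have h5 : L * ν ≤ L * D.card := by rw [hZc, mul_assoc] at h4; omega
    exact Nat.le_of_mul_le_mul_left h5 hLpos
  obtain ⟨U, hU, hUc⟩ := Finset.exists_subset_card_eq
    (s := D) (n := M) (by omega)
  -- many vertices `a` have at least `R` partners `d` in `U`
  set A := Z.filter fun a => R ≤ (U.filter fun d => rel a d).card with hAd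
  have hAc : ν ≤ 2 * A.card := by
    have h1 := sum_card_le_heavy U Z (fun d a => rel a d) R
    have hswap : ∑ a ∈ Z, (U.filter fun d => rel a d).card =
        ∑ d ∈ U, (Z.filter fun a => rel a d).card :=
      Finset.sum_card_bipartiteAbove_eq_sum_card_bipartiteBelow rel
    rw [hswap, ← hAd, ← hn, hUc] at h1
    have h2 : M * ν ≤ ∑ d ∈ U, (Z.filter fun a => rel a d).card := by
      rw [← hUc, ← smul_eq_mul]
      exact Finset.card_nsmul_le_sum _ _ _ fun d hd => (Finset.mem_filter.1 (hU hd)).2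
    have h3 : M * ν ≤ A.card * M + n * R := h2.trans h1
    have h4 : (2 * L * R) * (2 * ν) ≤ (2 * L * R) * (2 * A.card + ν) := by
      calc (2 * L * R) * (2 * ν) = M * ν := by rw [hM]; ring
        _ ≤ A.card * M + n * R := h3
        _ = _ := by rw [hZc, hM]; ring
    have := Nat.le_of_mul_le_mul_left h4 (by positivity)
    omega
  have hA' : A.card ≤ M ^ s * R := by
    refine (card_le_of_cover (R := R) A (U.powersetCard s)
      (fun a S => G.IsIndepSet (S : Set V) ∧ S.card = s ∧ ∀ d ∈ S, rel a d) ?_ ?_).trans ?_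
    · intro a ha
      obtain ⟨S, hS, hSc, hSi⟩ := hRs _ (Finset.mem_filter.1 ha).2
      exact ⟨S, Finset.mem_powersetCard.2 ⟨hS.trans (Finset.filter_subset _ _), hSc⟩, hSi, hSc,
        fun d hd => (Finset.mem_filter.1 (hS hd)).2⟩
    · intro S hS T' hT' h'
      rcases T'.eq_empty_or_nonempty with rfl | ⟨a, ha⟩
      · simp
      obtain ⟨d, hd⟩ := Finset.card_pos.1 (hs.trans_eq (Finset.mem_powersetCard.1 hS).2.symm)
      obtain ⟨hSi, hSc, had⟩ := h' a ha
      refine (hD c b S T' (had d hd).2.1.symm hSc hSi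
        (fun x hx => ⟨(had x hx).2.2.1, (had x hx).2.2.2.2.2⟩)
        fun y hy => ⟨((h' y hy).2.2 d hd).1.symm, fun h => ((h' y hy).2.2 d hd).2.2.2.1 h.symm,
          fun x hx h => ((h' y hy).2.2 x hx).2.2.2.2.1 h.symm⟩).le
    · have := card_powersetCard_le U s
      rw [hUc] at this
      exact Nat.mul_le_mul_right R this
  rw [mul_assoc 2 (M ^ s) R] at hν
  omega

end StableSets

/-! ### Traces on a template -/

section Traces
open Classical

variable {V : Type*}

/-- The vertex `y` extends the edge `u v` and the set `S` of `s` leaves at `u` by a first leaf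
at `v`. -/
structure IsHalf (G : SimpleGraph V) (s : ℕ) (u v : V) (S : Finset V) (y : V) : Prop where
  adj : G.Adj u v
  card_eq : S.card = s
  indep : G.IsIndepSet (S : Set V)
  leaf : ∀ x ∈ S, G.Adj u x ∧ ¬ G.Adj v x
  adj_right : G.Adj v y
  not_adj_left : ¬ G.Adj u y
  not_adj_leaf : ∀ x ∈ S, ¬ G.Adj x y

/-- If there is no double star, few vertices extend a configuration inside a given set `W`. -/
lemma card_le_of_isHalf {G : SimpleGraph V} {s R : ℕ} (hD : DoubleStarBdd G s R) (W T : Finset V)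
    (h : ∀ y ∈ T, ∃ u ∈ W, ∃ v ∈ W, ∃ S ⊆ W, IsHalf G s u v S y) :
    T.card ≤ W.card ^ (s + 2) * R := by
  refine (card_le_of_cover (R := R) T (W ×ˢ W ×ˢ W.powersetCard s)
    (fun y p => IsHalf G s p.1 p.2.1 p.2.2 y) (fun y hy => ?_) ?_).trans ?_
  · obtain ⟨u, hu, v, hv, S, hS, hh⟩ := h y hy
    exact ⟨(u, v, S), by simp [hu, hv, hS, hh.card_eq], hh⟩
  · rintro ⟨u, v, S⟩ - T' - h'
    rcases T'.eq_empty_or_nonempty with rfl | ⟨y, hy⟩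
    · simp
    · have hh := h' y hy
      exact (hD u v S T' hh.adj hh.card_eq hh.indep hh.leaf fun z hz =>
        ⟨(h' z hz).adj_right, (h' z hz).not_adj_left, (h' z hz).not_adj_leaf⟩).le
  · rw [Finset.card_product, Finset.card_product]
    refine Nat.mul_le_mul_right R ?_
    calc W.card * (W.card * (W.powersetCard s).card) ≤ W.card * (W.card * W.card ^ s) := by
          gcongr; exact card_powersetCard_le W s
      _ = W.card ^ (s + 2) := by ring

/-- The vertex `x` extends a configuration inside `U`, the union of the parts of a template; such
vertices are few, and all others attach to the template in a controlled way. -/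
def IsExc (G : SimpleGraph V) (s : ℕ) (U : Finset V) (x : V) : Prop :=
  ∃ u ∈ U, ∃ v ∈ U, ∃ S ⊆ U, IsHalf G s u v S x

/-- The *trace* of `x` on a template: the indices of the parts in which `x` misses at least `ρ`
vertices. -/
noncomputable def trace (G : SimpleGraph V) (ρ : ℕ) (I : Finset ℕ) (X : ℕ → Finset V) (x : V) :
    Finset ℕ :=
  I.filter fun i => ρ ≤ (misses G x (X i)).card

lemma mem_trace {G : SimpleGraph V} {ρ : ℕ} {I : Finset ℕ} {X : ℕ → Finset V} {x : V} {i : ℕ} :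
    i ∈ trace G ρ I X x ↔ i ∈ I ∧ ρ ≤ (misses G x (X i)).card := by simp [trace]

lemma trace_subset (G : SimpleGraph V) (ρ : ℕ) (I : Finset ℕ) (X : ℕ → Finset V) (x : V) :
    trace G ρ I X x ⊆ I := Finset.filter_subset _ _

lemma misses_lt_of_notMem_trace {G : SimpleGraph V} {ρ : ℕ} {I : Finset ℕ} {X : ℕ → Finset V}
    {x : V} {i : ℕ} (hi : i ∈ I) (h : i ∉ trace G ρ I X x) : (misses G x (X i)).card < ρ := by
  by_contra! hle
  exact h (mem_trace.2 ⟨hi, hle⟩)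

lemma card_le_card_add_of_cover {α : Type*} (S : Finset α) (X Y : Finset V) (bad : α → Finset V)
    {ρ : ℕ} (h : ∀ x ∈ S, (bad x).card ≤ ρ) (hY : ∀ p ∈ X, (∀ x ∈ S, p ∉ bad x) → p ∈ Y) :
    X.card ≤ Y.card + S.card * ρ := by
  refine (Finset.card_le_card (t := Y ∪ S.biUnion bad) fun p hp => ?_).trans
    ((Finset.card_union_le _ _).trans
      (Nat.add_le_add_left (Finset.card_biUnion_le_card_mul S bad ρ h) _))
  by_cases hp' : ∀ x ∈ S, p ∉ bad x
  · exact Finset.mem_union_left _ (hY p hp hp')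
  · push Not at hp'
    exact Finset.mem_union_right _ (Finset.mem_biUnion.2 hp')

section

variable {G : SimpleGraph V} {s r t : ℕ} {I : Finset ℕ} {X : ℕ → Finset V}

/-- A large subset of one part contains a vertex with `s` neighbours in a given large subset of
another part, whatever the order of the two parts. -/
lemma Template.exists_adj_subset (hT : Template G r t I X) {i j : ℕ} (hi : i ∈ I) (hj : j ∈ I)
    (hij : i ≠ j) {P Q : Finset V} (hP : P ⊆ X i) (hQ : Q ⊆ X j) (hPc : s * r < P.card)
    (hQc : r + s ≤ Q.card) : ∃ p ∈ P, ∃ S ⊆ Q, S.card = s ∧ ∀ z ∈ S, G.Adj p z := by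
  rcases lt_or_gt_of_ne hij with h | h
  · obtain ⟨S, hS, hSc⟩ := Finset.exists_subset_card_eq (s := Q) (n := s) (by omega)
    obtain ⟨p, hp, hpS⟩ := exists_common_adj (G := G) (K := S) (X := P) (r := r) (fun x hx =>
      (Finset.card_le_card (misses_mono G x hP)).trans (hT.near i hi j hj h x (hQ (hS hx))))
      (by rwa [hSc])
    exact ⟨p, hp, S, hS, hSc, fun z hz => (hpS z hz).symm⟩
  · obtain ⟨p, hp⟩ := Finset.card_pos.1 ((Nat.zero_le _).trans_lt hPc)
    have h1 := (Finset.card_le_card (misses_mono G p hQ)).trans (hT.near j hj i hi h p (hP hp))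
    have h2 := card_hits_add_card_misses G p Q
    obtain ⟨S, hS, hSc⟩ := Finset.exists_subset_card_eq (s := hits G p Q) (n := s) (by omega)
    exact ⟨p, hp, S, hS.trans (hits_subset G p Q), hSc, fun z hz => (mem_hits.1 (hS hz)).2⟩

/-- Let `v` be a vertex of the template missed by `x`. If `x` has a neighbour in `N(v) ∩ X i`, then
it misses fewer than `s` vertices of that set. -/
lemma Template.card_misses_hits_lt (hT : Template G r t I X) {x v p : V} {i : ℕ} (hi : i ∈ I)
    (hx : ¬ IsExc G s (I.biUnion X) x) (hv : v ∈ I.biUnion X) (hp : p ∈ X i) (hvp : G.Adj v p)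
    (hxp : G.Adj x p) (hxv : ¬ G.Adj x v) : (misses G x (hits G v (X i))).card < s := by
  by_contra! hle
  obtain ⟨S, hS, hSc⟩ := Finset.exists_subset_card_eq hle
  have hXU : X i ⊆ I.biUnion X := Finset.subset_biUnion_of_mem X hi
  have hSX : S ⊆ X i := hS.trans ((misses_subset G x _).trans (hits_subset G v _))
  refine hx ⟨v, hv, p, hXU hp, S, hSX.trans hXU, hvp, hSc, isIndepSet_mono (hT.indep i hi) hSX,
    fun z hz => ⟨?_, not_adj_of_isIndepSet (hT.indep i hi) hp (hSX hz)⟩, hxp.symm,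
    fun h => hxv h.symm, fun z hz h => (mem_misses.1 (hS hz)).2 h.symm⟩
  exact (mem_hits.1 (mem_misses.1 (hS hz)).1).2

lemma Template.not_adj_of_missed_later (hT : Template G r t I X) {x u v : V} {i j : ℕ}
    (hx : ¬ IsExc G s (I.biUnion X) x) (hi : i ∈ trace G (r + s) I X x) (hj : j ∈ I)
    (hij : i < j) (hv : v ∈ X j) (hxv : ¬ G.Adj x v) (hu : u ∈ X i) (hvu : G.Adj v u) :
    ¬ G.Adj x u := by
  intro hxu
  rw [mem_trace] at hi
  have h1 := hT.card_misses_hits_lt hi.1 hx (Finset.mem_biUnion.2 ⟨j, hj, hv⟩) hu hvu hxu hxv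
  have h2 := hT.near i hi.1 j hj hij v hv
  have h3 : (misses G x (X i)).card ≤
      (misses G x (hits G v (X i))).card + (misses G v (X i)).card := by
    refine (Finset.card_le_card fun z hz => ?_).trans (Finset.card_union_le _ _)
    rw [mem_misses] at hz
    by_cases hvz : G.Adj v z
    · exact Finset.mem_union_left _ (mem_misses.2 ⟨mem_hits.2 ⟨hz.1, hvz⟩, hz.2⟩)
    · exact Finset.mem_union_right _ (mem_misses.2 ⟨hz.1, hvz⟩)
  omega

lemma Template.card_hits_le_of_lt (hT : Template G r t I X) (hs : 0 < s) {x : V} {i j : ℕ}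
    (hx : ¬ IsExc G s (I.biUnion X) x) (hi : i ∈ trace G (r + s) I X x)
    (hj : j ∈ trace G (r + s) I X x) (hij : i < j) : (hits G x (X i)).card ≤ r := by
  have hj' := mem_trace.1 hj
  obtain ⟨v, hv⟩ := Finset.card_pos.1 (by omega : 0 < (misses G x (X j)).card)
  rw [mem_misses] at hv
  refine (Finset.card_le_card fun u hu => ?_).trans
    (hT.near i (mem_trace.1 hi).1 j hj'.1 hij v hv.1)
  rw [mem_hits] at hu
  exact mem_misses.2 ⟨hu.1, fun hvu =>
    hT.not_adj_of_missed_later hx hi hj'.1 hij hv.1 hv.2 hu.1 hvu hu.2⟩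

lemma Template.not_adj_of_lt (hT : Template G r t I X) (hs : 0 < s) (ht : (s + 2) * r < t)
    {x : V} {i j : ℕ} (hx : ¬ IsExc G s (I.biUnion X) x) (hi : i ∈ trace G (r + s) I X x)
    (hj : j ∈ trace G (r + s) I X x) (hij : i < j) {u : V} (hu : u ∈ X j) : ¬ G.Adj x u := by
  intro hxu
  have h1 := hT.card_hits_le_of_lt hs hx hi hj hij
  rw [mem_trace] at hi hj
  have h2 := card_hits_add_card_misses G x (X i)
  rw [hT.card_eq i hi.1] at h2
  obtain ⟨S, hS, hSc⟩ := Finset.exists_subset_card_eq (s := misses G x (X j)) (n := s) (by omega)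
  obtain ⟨v, hv, hvS⟩ := exists_common_adj (G := G) (K := insert u S) (X := misses G x (X i))
    (r := r) (fun z hz => (Finset.card_le_card (misses_mono G z (misses_subset G x (X i)))).trans
      (hT.near i hi.1 j hj.1 hij z (by
        rcases Finset.mem_insert.1 hz with rfl | hz
        · exact hu
        · exact (mem_misses.1 (hS hz)).1))) (by
      have h3 : (insert u S).card * r ≤ (s + 1) * r :=
        Nat.mul_le_mul_right r ((Finset.card_insert_le u S).trans (by omega))
      have h4 : (s + 2) * r = (s + 1) * r + r := by ring
      omega)
  rw [mem_misses] at hv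
  have h3 := hT.card_misses_hits_lt hj.1 hx (Finset.mem_biUnion.2 ⟨i, hi.1, hv.1⟩) hu
    (hvS u (Finset.mem_insert_self u S)).symm hxu hv.2
  have h4 : S ⊆ misses G x (hits G v (X j)) := fun z hz => by
    have hz' := mem_misses.1 (hS hz)
    exact mem_misses.2 ⟨mem_hits.2 ⟨hz'.1, (hvS z (Finset.mem_insert_of_mem hz)).symm⟩, hz'.2⟩
  have := Finset.card_le_card h4
  omega

/-- A vertex with at least two indices in its trace is nearly anticomplete to the corresponding
parts. -/
lemma Template.card_hits_le (hT : Template G r t I X) (hs : 0 < s) (ht : (s + 2) * r < t)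
    {x : V} {i j : ℕ} (hx : ¬ IsExc G s (I.biUnion X) x) (hi : i ∈ trace G (r + s) I X x)
    (hj : j ∈ trace G (r + s) I X x) (hij : i ≠ j) : (hits G x (X i)).card ≤ r := by
  rcases lt_or_gt_of_ne hij with h | h
  · exact hT.card_hits_le_of_lt hs hx hi hj h
  · have : hits G x (X i) = ∅ := Finset.eq_empty_of_forall_notMem fun u hu =>
      hT.not_adj_of_lt hs ht hx hj hi h (mem_hits.1 hu).1 (mem_hits.1 hu).2
    simp [this]

/-- A vertex whose trace is neither empty nor full has few neighbours with full trace. The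
double star to look at has one internal vertex `x` and the other, with its leaves, in the
template, one of the two in the last part `X m`. -/
lemma Template.card_full_trace_lt (hT : Template G r t I X) {R : ℕ} (hD : DoubleStarBdd G s R)
    (hs : 0 < s) (ht : (s + 2) * (r + s) < t) {m : ℕ} (hm : m ∈ I) (hlast : ∀ i ∈ I, i ≤ m)
    {x : V} (hne : (trace G (r + s) I X x).Nonempty) (hfull : trace G (r + s) I X x ≠ I)
    {T : Finset V} (hT' : ∀ y ∈ T, G.Adj x y ∧ ¬ IsExc G s (I.biUnion X) y ∧
      trace G (r + s) I X y = I) : T.card < R := by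
  have hst : (s + 2) * (r + s) = (s + 2) * r + (s + 2) * s := by ring
  have hst' : (s + 2) * r = s * r + 2 * r := by ring
  have hst'' : (s + 2) * s = s * s + 2 * s := by ring
  have hlt : ∀ i ∈ I, i ≠ m → i < m := fun i hi h => lt_of_le_of_ne (hlast i hi) h
  -- the behaviour of vertices `y` with full trace; some index other than `m` exists
  obtain ⟨j, hj⟩ := hne
  obtain ⟨i, hi, hix⟩ : ∃ i ∈ I, i ∉ trace G (r + s) I X x := by
    by_contra! h
    exact hfull (Finset.Subset.antisymm (trace_subset _ _ _ _ _) h)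
  have hjI := (mem_trace.1 hj).1
  have hij : i ≠ j := fun e => hix (e ▸ hj)
  obtain ⟨a, ha, ham⟩ : ∃ a ∈ I, a ≠ m := by
    by_cases h : i = m
    · exact ⟨j, hjI, fun e => hij (h.trans e.symm)⟩
    · exact ⟨i, hi, h⟩
  have hy1 : ∀ y ∈ T, ∀ v ∈ X m, ¬ G.Adj y v := fun y hy v hv => by
    obtain ⟨-, hye, hyI⟩ := hT' y hy
    exact hT.not_adj_of_lt hs (by omega) hye (by rwa [hyI]) (by rwa [hyI]) (hlt a ha ham) hv
  have hy2 : ∀ y ∈ T, ∀ v ∈ X m, ∀ b ∈ I, b ≠ m → ∀ u ∈ X b, G.Adj v u → ¬ G.Adj y u :=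
    fun y hy v hv b hb hbm u hu hvu => by
      obtain ⟨-, hye, hyI⟩ := hT' y hy
      exact hT.not_adj_of_missed_later hye (by rwa [hyI]) hm (hlt b hb hbm) hv
        (hy1 y hy v hv) hu hvu
  have hmis : ∀ b ∈ I, b ∉ trace G (r + s) I X x → t < (hits G x (X b)).card + (r + s) :=
    fun b hb hbx => by
      have h1 := misses_lt_of_notMem_trace hb hbx
      have h2 := card_hits_add_card_misses G x (X b)
      rw [hT.card_eq b hb] at h2
      omega
  by_cases hmx : m ∈ trace G (r + s) I X x
  · have him : i ≠ m := fun e => hix (e ▸ hmx)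
    have h1 := hmis i hi hix
    obtain ⟨p, hp, S, hS, hSc, hpS⟩ := hT.exists_adj_subset (s := s) hi hm him
      (hits_subset G x (X i)) (misses_subset G x (X m)) (by omega) (mem_trace.1 hmx).2
    rw [mem_hits] at hp
    have hSX : S ⊆ X m := hS.trans (misses_subset G x _)
    obtain ⟨v, hv⟩ := Finset.card_pos.1 (hs.trans_eq hSc.symm)
    exact hD p x S T hp.2.symm hSc (isIndepSet_mono (hT.indep m hm) hSX)
      (fun z hz => ⟨hpS z hz, (mem_misses.1 (hS hz)).2⟩) fun y hy => ⟨(hT' y hy).1,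
        fun h => hy2 y hy v (hSX hv) i hi him p hp.1 (hpS v hv).symm h.symm,
        fun z hz h => hy1 y hy z (hSX hz) h.symm⟩
  · have hjm : j ≠ m := fun e => hmx (e ▸ hj)
    have h1 := hmis m hm hmx
    obtain ⟨p, hp, S, hS, hSc, hpS⟩ := hT.exists_adj_subset (s := s) hm hjI hjm.symm
      (hits_subset G x (X m)) (misses_subset G x (X j)) (by omega) (mem_trace.1 hj).2
    rw [mem_hits] at hp
    have hSX : S ⊆ X j := hS.trans (misses_subset G x _)
    exact hD p x S T hp.2.symm hSc (isIndepSet_mono (hT.indep j hjI) hSX)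
      (fun z hz => ⟨hpS z hz, (mem_misses.1 (hS hz)).2⟩) fun y hy => ⟨(hT' y hy).1,
        fun h => hy1 y hy p hp.1 h.symm,
        fun z hz h => hy2 y hy p hp.1 j hjI hjm z (hSX hz) (hpS z hz) h.symm⟩

lemma Template.exists_separating_edge_of_lt (hT : Template G r t I X) (hs : 0 < s)
    (ht : 2 * (r + s) < t) {x y : V} {i j : ℕ} (hy : ¬ IsExc G s (I.biUnion X) y)
    (hi : i ∈ trace G (r + s) I X x) (hj : j ∈ trace G (r + s) I X y)
    (hiy : i ∉ trace G (r + s) I X y) (hjx : j ∉ trace G (r + s) I X x) (hij : i < j) :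
    ∃ p ∈ I.biUnion X, ∃ q ∈ I.biUnion X,
      G.Adj p q ∧ G.Adj p x ∧ ¬ G.Adj p y ∧ G.Adj q y ∧ ¬ G.Adj q x := by
  rw [mem_trace] at hi hj
  have h1 := misses_lt_of_notMem_trace hj.1 hjx
  have h2 := misses_lt_of_notMem_trace hi.1 hiy
  obtain ⟨p, hpy, hpx⟩ := Finset.exists_mem_notMem_of_card_lt_card (h1.trans_le hj.2)
  rw [mem_misses] at hpy
  have hpx' : G.Adj x p := by
    by_contra h
    exact hpx (mem_misses.2 ⟨hpy.1, h⟩)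
  have hpU : p ∈ I.biUnion X := Finset.mem_biUnion.2 ⟨j, hj.1, hpy.1⟩
  have h3 := hT.near i hi.1 j hj.1 hij p hpy.1
  have h4 : ∃ u ∈ X i, u ∉ misses G p (X i) ∪ misses G y (X i) := by
    have := Finset.card_union_le (misses G p (X i)) (misses G y (X i))
    exact Finset.exists_mem_notMem_of_card_lt_card (by rw [hT.card_eq i hi.1]; omega)
  obtain ⟨u, hu, hu'⟩ := h4
  simp only [Finset.mem_union, mem_misses, hu, true_and, not_or, not_not] at hu'
  have h5 := hT.card_misses_hits_lt hi.1 hy hpU hu hu'.1 hu'.2 hpy.2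
  have h6 := Finset.card_union_le (misses G p (X i)) (misses G y (hits G p (X i)))
  obtain ⟨q, hqx, hq⟩ := Finset.exists_mem_notMem_of_card_lt_card
    (s := misses G p (X i) ∪ misses G y (hits G p (X i))) (t := misses G x (X i)) (by omega)
  rw [mem_misses] at hqx
  simp only [Finset.mem_union, mem_misses, mem_hits, hqx.1, true_and, not_or, not_and,
    not_not] at hq
  exact ⟨p, hpU, q, Finset.mem_biUnion.2 ⟨i, hi.1, hqx.1⟩, hq.1, hpx'.symm,
    fun h => hpy.2 h.symm, (hq.2 hq.1).symm, fun h => hqx.2 h.symm⟩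

/-- Two vertices with nonempty disjoint traces are separated by an edge `p q` of the template: if
they were nonadjacent, they would form a four-vertex path with it. -/
lemma Template.exists_separating_edge (hT : Template G r t I X) (hs : 0 < s)
    (ht : 2 * (r + s) < t) {x y : V} (hx : ¬ IsExc G s (I.biUnion X) x)
    (hy : ¬ IsExc G s (I.biUnion X) y) (hxn : (trace G (r + s) I X x).Nonempty)
    (hyn : (trace G (r + s) I X y).Nonempty)
    (hxy : Disjoint (trace G (r + s) I X x) (trace G (r + s) I X y)) :
    ∃ p ∈ I.biUnion X, ∃ q ∈ I.biUnion X,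
      G.Adj p q ∧ G.Adj p x ∧ ¬ G.Adj p y ∧ G.Adj q y ∧ ¬ G.Adj q x := by
  obtain ⟨i, hi⟩ := hxn
  obtain ⟨j, hj⟩ := hyn
  have hiy := Finset.disjoint_left.1 hxy hi
  have hjx := Finset.disjoint_right.1 hxy hj
  rcases lt_or_gt_of_ne (fun e => hiy (e ▸ hj) : i ≠ j) with h | h
  · exact hT.exists_separating_edge_of_lt hs ht hy hi hj hiy hjx h
  · obtain ⟨p, hp, q, hq, h1, h2, h3, h4, h5⟩ :=
      hT.exists_separating_edge_of_lt hs ht hx hj hi hjx hiy h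
    exact ⟨q, hq, p, hp, h1.symm, h4, h5, h2, h3⟩

/-- Crossing traces: many vertices `x` with `i`, `j` but not `l` in their traces exclude many
vertices `y` with `j`, `l` but not `i` in their traces. An adjacent pair `x`, `y` extends a
configuration with internal vertices `x` and `p ∈ X l` and leaves in `X j`. A vertex `y`
nonadjacent to `s` stable vertices `x` extends a configuration with these as leaves and an edge
between `X l` and `X i`. -/
lemma Template.card_crossing_le (hT : Template G r t I X) {R : ℕ} (hD : DoubleStarBdd G s R)
    (hRs : ForcesStable G R s) (hs : 0 < s) (ht : 4 * (s + 1) * (r + s) < t) {i j l : ℕ}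
    (hi : i ∈ I) (hj : j ∈ I) (hl : l ∈ I) (hij : i ≠ j) (hjl : j ≠ l) (hil : i ≠ l)
    {A B : Finset V}
    (hA : ∀ x ∈ A, ¬ IsExc G s (I.biUnion X) x ∧ i ∈ trace G (r + s) I X x ∧
      j ∈ trace G (r + s) I X x ∧ l ∉ trace G (r + s) I X x)
    (hB : ∀ y ∈ B, ¬ IsExc G s (I.biUnion X) y ∧ j ∈ trace G (r + s) I X y ∧
      l ∈ trace G (r + s) I X y ∧ i ∉ trace G (r + s) I X y) (hAR : R ≤ A.card) :
    B.card ≤ (s + 1) * (((I.biUnion X).card + s + 1) ^ (s + 2) * R) := by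
  set U := I.biUnion X with hU
  have hXU : ∀ i ∈ I, X i ⊆ U := fun i hi => Finset.subset_biUnion_of_mem X hi
  have e1 : 4 * (s + 1) * (r + s) = 4 * (s * r) + 4 * (s * s) + 4 * r + 4 * s := by ring
  have e2 : s * (r + s) = s * r + s * s := by ring
  have ht2 : (s + 2) * r < t := by
    have : (s + 2) * r = s * r + 2 * r := by ring
    omega
  have hAi : ∀ x ∈ A, (hits G x (X i)).card ≤ r := fun x hx =>
    hT.card_hits_le hs ht2 (hA x hx).1 (hA x hx).2.1 (hA x hx).2.2.1 hij
  have hAj : ∀ x ∈ A, (hits G x (X j)).card ≤ r := fun x hx =>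
    hT.card_hits_le hs ht2 (hA x hx).1 (hA x hx).2.2.1 (hA x hx).2.1 hij.symm
  have hAl : ∀ x ∈ A, (misses G x (X l)).card ≤ r + s := fun x hx =>
    (misses_lt_of_notMem_trace hl (hA x hx).2.2.2).le
  have hBj : ∀ y ∈ B, (hits G y (X j)).card ≤ r := fun y hy =>
    hT.card_hits_le hs ht2 (hB y hy).1 (hB y hy).2.1 (hB y hy).2.2.1 hjl
  have hBl : ∀ y ∈ B, (hits G y (X l)).card ≤ r := fun y hy =>
    hT.card_hits_le hs ht2 (hB y hy).1 (hB y hy).2.2.1 (hB y hy).2.1 hjl.symm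
  have hBi : ∀ y ∈ B, (misses G y (X i)).card ≤ r + s := fun y hy =>
    (misses_lt_of_notMem_trace hi (hB y hy).2.2.2).le
  have hsparse : ∀ x ∈ A, (hits G x B).card ≤ (U.card + s + 1) ^ (s + 2) * R := by
    intro x hx
    refine (card_le_of_isHalf hD (insert x U) _ fun y hy => ?_).trans
      (Nat.mul_le_mul_right R (Nat.pow_le_pow_left
        ((Finset.card_insert_le x U).trans (by omega)) _))
    rw [mem_hits] at hy
    have c1 := Finset.le_card_sdiff (hits G y (X l)) (hits G x (X l))
    have c2 := card_hits_add_card_misses G x (X l)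
    have c3 := Finset.le_card_sdiff (hits G y (X j)) (misses G x (X j))
    have c4 := card_hits_add_card_misses G x (X j)
    rw [hT.card_eq l hl] at c2
    rw [hT.card_eq j hj] at c4
    have b1 := hBl y hy.1
    have b2 := hBj y hy.1
    have b3 := hAl x hx
    have b4 := hAj x hx
    obtain ⟨p, hp, S, hS, hSc, hpS⟩ := hT.exists_adj_subset (s := s) hl hj hjl.symm
      (P := hits G x (X l) \ hits G y (X l)) (Q := misses G x (X j) \ hits G y (X j))
      (Finset.sdiff_subset.trans (hits_subset G x _))
      (Finset.sdiff_subset.trans (misses_subset G x _)) (by omega) (by omega)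
    simp only [Finset.mem_sdiff, mem_hits, not_and] at hp
    have hSX : S ⊆ X j := hS.trans (Finset.sdiff_subset.trans (misses_subset G x _))
    refine ⟨p, Finset.mem_insert_of_mem (hXU l hl hp.1.1), x, Finset.mem_insert_self x U, S,
      (hSX.trans (hXU j hj)).trans (Finset.subset_insert x U), hp.1.2.symm, hSc,
      isIndepSet_mono (hT.indep j hj) hSX, fun z hz => ⟨hpS z hz, ?_⟩, hy.2,
      fun h => hp.2 hp.1.1 h.symm, fun z hz h => ?_⟩
    · exact (mem_misses.1 (Finset.mem_sdiff.1 (hS hz)).1).2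
    · exact (Finset.mem_sdiff.1 (hS hz)).2 (mem_hits.2 ⟨hSX hz, h.symm⟩)
  obtain ⟨S, hS, hSc, hSi⟩ := hRs A hAR
  have hanti : (B.filter fun y => ∀ x ∈ S, ¬ G.Adj x y).card ≤
      (U.card + s + 1) ^ (s + 2) * R := by
    refine (card_le_of_isHalf hD (U ∪ S) _ fun y hy => ?_).trans
      (Nat.mul_le_mul_right R (Nat.pow_le_pow_left
        ((Finset.card_union_le U S).trans (by omega)) _))
    rw [Finset.mem_filter] at hy
    set P := (X l).filter fun p => ∀ x ∈ S, G.Adj x p with hP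
    set Q := (X i).filter fun q => ∀ x ∈ S, ¬ G.Adj x q with hQ
    have c1 := card_le_card_add_of_cover S (X l) P (fun x => misses G x (X l)) (ρ := r + s)
      (fun x hx => hAl x (hS hx)) fun p hp h => Finset.mem_filter.2 ⟨hp, fun x hx => by
        simpa [hp] using h x hx⟩
    have c2 := card_le_card_add_of_cover S (X i) Q (fun x => hits G x (X i)) (ρ := r)
      (fun x hx => hAi x (hS hx)) fun p hp h => Finset.mem_filter.2 ⟨hp, fun x hx => by
        simpa [hp] using h x hx⟩
    rw [hT.card_eq l hl, hSc] at c1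
    rw [hT.card_eq i hi, hSc] at c2
    have c3 := Finset.le_card_sdiff (hits G y (X l)) P
    have c4 := Finset.le_card_sdiff (misses G y (X i)) Q
    have b1 := hBl y hy.1
    have b2 := hBi y hy.1
    obtain ⟨p, hp, S', hS', hSc', hpS'⟩ := hT.exists_adj_subset (s := s) hl hi hil.symm
      (P := P \ hits G y (X l)) (Q := Q \ misses G y (X i))
      (Finset.sdiff_subset.trans (Finset.filter_subset _ _))
      (Finset.sdiff_subset.trans (Finset.filter_subset _ _)) (by omega) (by omega)
    obtain ⟨q, hq⟩ := Finset.card_pos.1 (hs.trans_eq hSc'.symm)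
    have hpq := hpS' q hq
    replace hq := hS' hq
    simp only [Finset.mem_sdiff, hP, hQ, Finset.mem_filter, mem_hits, mem_misses, not_and,
      not_not] at hp hq
    exact ⟨p, Finset.mem_union_left _ (hXU l hl hp.1.1), q,
      Finset.mem_union_left _ (hXU i hi hq.1.1), S, Finset.subset_union_right, hpq, hSc, hSi,
      fun x hx => ⟨(hp.1.2 x hx).symm, fun h => hq.1.2 x hx h.symm⟩, (hq.2 hq.1.1).symm,
      fun h => hp.2 hp.1.1 h.symm, hy.2⟩
  have hcov : B ⊆ (S.biUnion fun x => hits G x B) ∪ B.filter fun y => ∀ x ∈ S, ¬ G.Adj x y := by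
    intro y hy
    by_cases h : ∀ x ∈ S, ¬ G.Adj x y
    · exact Finset.mem_union_right _ (Finset.mem_filter.2 ⟨hy, h⟩)
    · push Not at h
      obtain ⟨x, hx, hxy⟩ := h
      exact Finset.mem_union_left _ (Finset.mem_biUnion.2 ⟨x, hx, mem_hits.2 ⟨hy, hxy⟩⟩)
  have h1 := (Finset.card_le_card hcov).trans (Finset.card_union_le _ _)
  have h2 := Finset.card_biUnion_le_card_mul S (fun x => hits G x B) _ fun x hx =>
    hsparse x (hS hx)
  rw [hSc] at h2
  rw [add_mul, one_mul]
  omega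

/-- A set of vertices all of which are nearly complete to the part `X i` has clique number smaller
than the whole. -/
lemma Template.cliqueBdd_of_near (hT : Template G r t I X) {Z A : Finset V} {w τ ρ i : ℕ}
    (hZ : CliqueBdd G Z w) (hAZ : A ⊆ Z) (hi : i ∈ I) (hXZ : X i ⊆ Z) (hw : w ≤ τ)
    (ht : τ * ρ < t) (hA : ∀ x ∈ A, (misses G x (X i)).card ≤ ρ) :
    CliqueBdd G A (w - 1) := by
  intro K hK hKc
  have h1 := hZ K (hK.trans hAZ) hKc
  obtain ⟨p, hp, hpK⟩ := exists_common_adj (G := G) (K := K) (X := X i) (r := ρ)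
    (fun x hx => hA x (hK hx)) (by
      rw [hT.card_eq i hi]
      exact lt_of_le_of_lt (Nat.mul_le_mul_right ρ (h1.trans hw)) ht)
  have hpK' : p ∉ K := fun h => G.irrefl (hpK p h)
  have h2 := hZ (insert p K) (Finset.insert_subset (hXZ hp) (hK.trans hAZ)) (by
    rw [Finset.coe_insert, SimpleGraph.isClique_insert]
    exact ⟨hKc, fun b hb _ => (hpK b (by exact_mod_cast hb)).symm⟩)
  rw [Finset.card_insert_of_notMem hpK'] at h2
  omega

end

end Traces

/-! ### Splitting off sets with disjoint traces -/

section Structure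
open Classical

variable {V : Type*}

/-- For some `a` there are `T` disjoint cliques of size `a` in `A`, while few vertices meet all
larger cliques. (For `a = 0` the disjoint cliques carry no information and are omitted.) -/
lemma exists_disjoint_cliques {G : SimpleGraph V} {A : Finset V} {w T : ℕ}
    (hA : CliqueBdd G A w) (hT : 0 < T) :
    ∃ a ≤ w, (a = 0 ∨ ∃ 𝒦 : Finset (Finset V), 𝒦.card = T ∧
        (∀ K ∈ 𝒦, K ⊆ A ∧ K.card = a ∧ G.IsClique (K : Set V)) ∧
        ∀ K ∈ 𝒦, ∀ K' ∈ 𝒦, K ≠ K' → Disjoint K K') ∧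
      ∃ H ⊆ A, H.card ≤ T * (a + 1) ∧ CliqueBdd G (A \ H) a := by
  set P : ℕ → Prop := fun a => a = 0 ∨ ∃ 𝒦 : Finset (Finset V), 𝒦.card = T ∧
        (∀ K ∈ 𝒦, K ⊆ A ∧ K.card = a ∧ G.IsClique (K : Set V)) ∧
        ∀ K ∈ 𝒦, ∀ K' ∈ 𝒦, K ≠ K' → Disjoint K K' with hP
  have hex : ∃ a ≤ w, P a ∧ ¬ P (a + 1) := by
    by_contra! hcon
    have hall : ∀ a ≤ w + 1, P a := by
      intro a
      induction a with
      | zero => exact fun _ => Or.inl rfl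
      | succ a ih => exact fun h => hcon a (by omega) (ih (by omega))
    rcases hall (w + 1) le_rfl with h | ⟨𝒦, h𝒦, hK, -⟩
    · omega
    · obtain ⟨K, hK𝒦⟩ := Finset.card_pos.1 (hT.trans_eq h𝒦.symm)
      have h1 := hK K hK𝒦
      have := hA K h1.1 h1.2.2
      omega
  obtain ⟨a, haw, ha, ha'⟩ := hex
  refine ⟨a, haw, ha, ?_⟩
  obtain ⟨𝒦, h𝒦, hmax⟩ := Finset.exists_max_image
    (A.powerset.powerset.filter fun 𝒦 : Finset (Finset V) =>
      (∀ K ∈ 𝒦, K ⊆ A ∧ K.card = a + 1 ∧ G.IsClique (K : Set V)) ∧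
        ∀ K ∈ 𝒦, ∀ K' ∈ 𝒦, K ≠ K' → Disjoint K K') Finset.card ⟨∅, by simp⟩
  rw [Finset.mem_filter] at h𝒦
  obtain ⟨-, hK, hdisj⟩ := h𝒦
  have hlt : 𝒦.card < T := by
    by_contra! hle
    obtain ⟨𝒦', hs, hc⟩ := Finset.exists_subset_card_eq hle
    exact ha' (Or.inr ⟨𝒦', hc, fun K h => hK K (hs h),
      fun K h K' h' => hdisj K (hs h) K' (hs h')⟩)
  refine ⟨𝒦.biUnion id, Finset.biUnion_subset.2 fun K h => (hK K h).1, ?_, fun K hKs hKc => ?_⟩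
  · exact (Finset.card_biUnion_le_card_mul 𝒦 id (a + 1) fun K h => (hK K h).2.1.le).trans
      (Nat.mul_le_mul_right _ hlt.le)
  · by_contra! hle
    obtain ⟨K', hK', hK'c⟩ := Finset.exists_subset_card_eq (s := K) (n := a + 1) hle
    have hdis : ∀ L ∈ 𝒦, Disjoint K' L := fun L hL => Finset.disjoint_left.2 fun x hx hxL =>
      (Finset.mem_sdiff.1 (hKs (hK' hx))).2 (Finset.mem_biUnion.2 ⟨L, hL, hxL⟩)
    have hnot : K' ∉ 𝒦 := fun h => by
      have := Finset.disjoint_self_iff_empty K' |>.1 (hdis K' h)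
      rw [this] at hK'c
      simp at hK'c
    have hK'A : K' ⊆ A := hK'.trans (hKs.trans Finset.sdiff_subset)
    have hK'' : ∀ L ∈ insert K' 𝒦, L ⊆ A ∧ L.card = a + 1 ∧ G.IsClique (L : Set V) := by
      intro L hL
      rcases Finset.mem_insert.1 hL with rfl | hL
      · exact ⟨hK'A, hK'c, hKc.subset (by exact_mod_cast hK')⟩
      · exact hK L hL
    have := hmax (insert K' 𝒦) (Finset.mem_filter.2 ⟨Finset.mem_powerset.2 fun L hL =>
      Finset.mem_powerset.2 (hK'' L hL).1, hK'', fun L hL L' hL' hne => by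
        rcases Finset.mem_insert.1 hL with hLe | hLm <;>
          rcases Finset.mem_insert.1 hL' with hLe' | hLm'
        · exact absurd (hLe.trans hLe'.symm) hne
        · exact hLe ▸ hdis L' hLm'
        · exact hLe' ▸ (hdis L hLm).symm
        · exact hdisj L hLm L' hLm' hne⟩)
    rw [Finset.card_insert_of_notMem hnot] at this
    omega

/-- Suppose that any `x ∈ A` and `y ∈ B` are separated by an edge of `U`. Then up to the removal of
a small set `C`, the clique bounds of `A` and `B` add up to at most that of `A ∪ B`. For take many
disjoint cliques of the largest possible size in `A`. All but few `y ∈ B` miss few vertices of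
their union: otherwise `y` misses a stable set of `s` vertices that are separated from `y` by the
same edge. So any clique in the rest of `B` is complete to one of the cliques. -/
lemma exists_split {G : SimpleGraph V} {s R τ w : ℕ} (hD : DoubleStarBdd G s R)
    (hRs : ForcesStable G R s) {U Z A B : Finset V} {n : ℕ} (hU : U.card ≤ n)
    (hZ : CliqueBdd G Z w) (hw : w ≤ τ) (hA : A ⊆ Z) (hB : B ⊆ Z)
    (hAB : ∀ x ∈ A, ∀ y ∈ B, ∃ p ∈ U, ∃ q ∈ U,
      G.Adj p q ∧ G.Adj p x ∧ ¬ G.Adj p y ∧ G.Adj q y ∧ ¬ G.Adj q x) :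
    ∃ (C : Finset V) (a b : ℕ), C.card ≤ (τ * (n * n * R) + 1) * (τ + 1) +
        (n + (τ * (n * n * R) + 1) * τ) ^ (s + 2) * R ∧
      CliqueBdd G (A \ C) a ∧ CliqueBdd G (B \ C) b ∧ a + b ≤ w := by
  set T := τ * (n * n * R) + 1 with hT
  obtain ⟨a, haw, ha, H, -, hHc, hHa⟩ := exists_disjoint_cliques (hZ.mono hA le_rfl)
    (Nat.succ_pos _ : 0 < T)
  have hHc' : H.card ≤ T * (τ + 1) := hHc.trans (Nat.mul_le_mul_left T (by omega))
  rcases ha with rfl | ⟨𝒦, h𝒦, hK, hdisj⟩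
  · exact ⟨H, 0, w, hHc'.trans (Nat.le_add_right _ _), hHa,
      hZ.mono (Finset.sdiff_subset.trans hB) le_rfl, by omega⟩
  set L := 𝒦.biUnion id with hL
  have hLA : L ⊆ A := Finset.biUnion_subset.2 fun K h => (hK K h).1
  have hLc : L.card ≤ T * τ := by
    have := Finset.card_biUnion_le_card_mul 𝒦 id τ fun K h => (hK K h).2.1.le.trans (by omega)
    rwa [h𝒦] at this
  set E := B.filter fun y => n * n * R < (misses G y L).card with hE
  have hEc : E.card ≤ (n + T * τ) ^ (s + 2) * R := by
    refine (card_le_of_isHalf hD (U ∪ L) E fun y hy => ?_).trans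
      (Nat.mul_le_mul_right R (Nat.pow_le_pow_left
        ((Finset.card_union_le U L).trans (by omega)) _))
    rw [Finset.mem_filter] at hy
    by_contra! hcon
    have hbound := card_le_of_cover (R := R) (misses G y L) (U ×ˢ U)
      (fun x e => G.Adj e.1 e.2 ∧ G.Adj e.1 x ∧ ¬ G.Adj e.1 y ∧ G.Adj e.2 y ∧ ¬ G.Adj e.2 x)
      (fun x hx => by
        obtain ⟨p, hp, q, hq, h⟩ := hAB x (hLA (mem_misses.1 hx).1) y hy.1
        exact ⟨(p, q), Finset.mem_product.2 ⟨hp, hq⟩, h⟩)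
      (by
        rintro ⟨p, q⟩ hpq T' hT' h'
        by_contra! hlt
        rw [Finset.mem_product] at hpq
        obtain ⟨x, hx⟩ := Finset.card_pos.1 ((Nat.zero_le _).trans_lt hlt)
        obtain ⟨S, hS, hSc, hSi⟩ := hRs T' hlt.le
        refine hcon p (Finset.mem_union_left _ hpq.1) q (Finset.mem_union_left _ hpq.2) S
          (fun z hz => Finset.mem_union_right _ (mem_misses.1 (hT' (hS hz))).1)
          ⟨(h' x hx).1, hSc, hSi, fun z hz => ⟨(h' z (hS hz)).2.1, (h' z (hS hz)).2.2.2.2⟩,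
            (h' x hx).2.2.2.1, (h' x hx).2.2.1,
            fun z hz h => (mem_misses.1 (hT' (hS hz))).2 h.symm⟩)
    rw [Finset.card_product] at hbound
    have := Nat.mul_le_mul_right R (Nat.mul_le_mul hU hU)
    omega
  refine ⟨H ∪ E, a, w - a, (Finset.card_union_le H E).trans (Nat.add_le_add hHc' hEc),
    hHa.mono (Finset.sdiff_subset_sdiff subset_rfl Finset.subset_union_left) le_rfl,
    fun K hKs hKc => ?_, by omega⟩
  have hKB : ∀ y ∈ K, y ∈ B ∧ (misses G y L).card ≤ n * n * R := fun y hy => by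
    have h := Finset.mem_sdiff.1 (hKs hy)
    refine ⟨h.1, ?_⟩
    by_contra! hlt
    exact h.2 (Finset.mem_union_right _ (Finset.mem_filter.2 ⟨h.1, hlt⟩))
  have hKZ : K ⊆ Z := fun y hy => hB (hKB y hy).1
  have hKτ : K.card ≤ τ := (hZ K hKZ hKc).trans hw
  -- one of the disjoint cliques avoids everything that `K` misses
  obtain ⟨K', hK', hcomp⟩ : ∃ K' ∈ 𝒦, ∀ y ∈ K, ∀ x ∈ K', G.Adj y x := by
    by_contra! hcon
    have h1 : 𝒦.card ≤ (K.biUnion fun y => misses G y L).card := by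
      have hpick : ∀ K' : Finset V, ∃ x, K' ∈ 𝒦 → x ∈ K' ∧ ∃ y ∈ K, ¬ G.Adj y x := by
        intro K'
        by_cases h : K' ∈ 𝒦
        · obtain ⟨y, hy, x, hx, hyx⟩ := hcon K' h
          exact ⟨x, fun _ => ⟨hx, y, hy, hyx⟩⟩
        · obtain ⟨K₀, hK₀⟩ := Finset.card_pos.1 ((Nat.succ_pos _).trans_eq h𝒦.symm)
          obtain ⟨y, -, -⟩ := hcon K₀ hK₀
          exact ⟨y, fun h' => absurd h' h⟩
      choose f hf using hpick
      refine Finset.card_le_card_of_injOn f (fun K' hK' => ?_) fun K₁ h₁ K₂ h₂ e => ?_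
      · obtain ⟨hx, y, hy, hyx⟩ := hf K' hK'
        exact Finset.mem_coe.2 (Finset.mem_biUnion.2 ⟨y, hy, mem_misses.2
          ⟨Finset.mem_biUnion.2 ⟨K', hK', hx⟩, hyx⟩⟩)
      · by_contra hne
        exact Finset.disjoint_left.1 (hdisj K₁ h₁ K₂ h₂ hne) (hf K₁ h₁).1 (e ▸ (hf K₂ h₂).1)
    have h2 := Finset.card_biUnion_le_card_mul K (fun y => misses G y L) (n * n * R)
      fun y hy => (hKB y hy).2
    have h3 := Nat.mul_le_mul_right (n * n * R) hKτ
    omega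
  have h1 := hK K' hK'
  have hdis : Disjoint K K' := Finset.disjoint_left.2 fun x hx hx' => G.irrefl (hcomp x hx x hx')
  have h2 := hZ (K ∪ K') (Finset.union_subset hKZ (h1.1.trans hA)) (by
    intro x hx y hy hne
    rcases Finset.mem_union.1 (Finset.mem_coe.1 hx) with hx | hx <;>
      rcases Finset.mem_union.1 (Finset.mem_coe.1 hy) with hy | hy
    · exact hKc hx hy hne
    · exact hcomp x hx y hy
    · exact (hcomp y hy x hx).symm
    · exact h1.2.2 hx hy hne)
  rw [Finset.card_union_of_disjoint hdis, h1.2.1] at h2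
  omega

/-- Without a two-part template some vertex of `Z` has small degree. For let `v` have minimum
degree. Most neighbours of `v` have few neighbours outside `N(v)`, since for a stable set `P` of
neighbours of `v` few vertices are nearly complete to `P`, and few extend a configuration in
`P ∪ {v}`. So most neighbours of `v` are adjacent to nearly all of `N(v)`, which however contains
a large stable set. -/
lemma exists_pair_of_degree {G : SimpleGraph V} {s R t : ℕ} {N : ℕ → ℕ}
    (hD : DoubleStarBdd G s R) (hN : ∀ t, ForcesStable G (N t) t) (ht : 0 < t) {Z : Finset V}
    (hZ : Z.Nonempty) (hdeg : ∀ v ∈ Z,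
      N t + N ((t + 1) ^ (s + 2) * R + N t + 1) ≤ (hits G v Z).card) :
    ∃ P ⊆ Z, ∃ Q ⊆ Z, (P.card = t ∧ G.IsIndepSet (P : Set V)) ∧
      (Q.card = t ∧ G.IsIndepSet (Q : Set V)) ∧ ∀ x ∈ Q, (misses G x P).card ≤ s := by
  by_contra hno
  obtain ⟨v, hv, hmin⟩ := Finset.exists_min_image Z (fun v => (hits G v Z).card) hZ
  set d := (t + 1) ^ (s + 2) * R + N t with hd
  set B := (hits G v Z).filter fun p => d < (misses G v (hits G p Z)).card with hB
  have hBc : B.card < N t := by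
    by_contra! hle
    obtain ⟨P, hP, hPc, hPi⟩ := hN t B hle
    have hPv : ∀ p ∈ P, p ∈ Z ∧ G.Adj v p := fun p hp =>
      mem_hits.1 (Finset.mem_filter.1 (hP hp)).1
    have hPZ : P ⊆ Z := fun p hp => (hPv p hp).1
    obtain ⟨p, hp⟩ := Finset.card_pos.1 (ht.trans_eq hPc.symm)
    set W := Z.filter fun x => (misses G x P).card ≤ s with hW
    have hWc : W.card < N t := by
      by_contra! hle
      obtain ⟨Q, hQ, hQc, hQi⟩ := hN t W hle
      exact hno ⟨P, hPZ, Q, hQ.trans (Finset.filter_subset _ _), ⟨hPc, hPi⟩, ⟨hQc, hQi⟩,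
        fun x hx => (Finset.mem_filter.1 (hQ hx)).2⟩
    have hrest : (misses G v (hits G p Z) \ W).card ≤ (t + 1) ^ (s + 2) * R := by
      refine (card_le_of_isHalf hD (insert v P) _ fun y hy => ?_).trans
        (Nat.mul_le_mul_right R (Nat.pow_le_pow_left
          ((Finset.card_insert_le v P).trans (by omega)) _))
      simp only [Finset.mem_sdiff, mem_misses, mem_hits] at hy
      obtain ⟨⟨⟨hyZ, hpy⟩, hvy⟩, hyW⟩ := hy
      have hlt : s < (misses G y P).card := by
        by_contra! hle
        exact hyW (Finset.mem_filter.2 ⟨hyZ, hle⟩)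
      obtain ⟨S, hS, hSc⟩ := Finset.exists_subset_card_eq hlt.le
      have hSP : S ⊆ P := hS.trans (misses_subset G y P)
      exact ⟨v, Finset.mem_insert_self v P, p, Finset.mem_insert_of_mem hp, S,
        hSP.trans (Finset.subset_insert v P), (hPv p hp).2, hSc, isIndepSet_mono hPi hSP,
        fun z hz => ⟨(hPv z (hSP hz)).2, not_adj_of_isIndepSet hPi hp (hSP hz)⟩, hpy, hvy,
        fun z hz h => (mem_misses.1 (hS hz)).2 h.symm⟩
    have h1 := (Finset.mem_filter.1 (hP hp)).2
    have h2 : (misses G v (hits G p Z)).card ≤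
        (misses G v (hits G p Z) \ W).card + W.card := by
      have := Finset.le_card_sdiff W (misses G v (hits G p Z))
      omega
    omega
  obtain ⟨P, hP, hPc, hPi⟩ := hN (d + 1) (hits G v Z \ B) (by
    have h1 := Finset.le_card_sdiff B (hits G v Z)
    have h2 := hdeg v hv
    omega)
  obtain ⟨p, hp⟩ := Finset.card_pos.1 ((Nat.succ_pos d).trans_eq hPc.symm)
  have hpB := Finset.mem_sdiff.1 (hP hp)
  have hpv := mem_hits.1 hpB.1
  have h1 : (misses G v (hits G p Z)).card ≤ d := by
    by_contra! hlt
    exact hpB.2 (Finset.mem_filter.2 ⟨hpB.1, hlt⟩)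
  have h2 : hits G v (hits G p Z) ⊆ hits G v Z \ P := fun x hx => by
    simp only [mem_hits] at hx
    exact Finset.mem_sdiff.2 ⟨mem_hits.2 ⟨hx.1.1, hx.2⟩, fun hxP =>
      not_adj_of_isIndepSet hPi hp hxP hx.1.2⟩
  have h3 := Finset.card_le_card h2
  rw [Finset.card_sdiff_of_subset (hP.trans Finset.sdiff_subset)] at h3
  have h4 := card_hits_add_card_misses G v (hits G p Z)
  have h5 := hmin p hpv.1
  have h6 := Finset.card_le_card (hP.trans (Finset.sdiff_subset (s := hits G v Z) (t := B)))
  omega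

end Structure

/-! ### Peeling in graphs without a double star -/

section Peeling
open Classical

variable {V : Type*}

/-- The size of the parts of the templates used for excluding a double star. -/
def doubleStarPart (τ s : ℕ) : ℕ := (4 * (s + 1) + τ + 1) * ((τ + 1) * s) + 1

/-- The size below which a set of vertices with crossing traces is discarded, where `n` bounds the
number of vertices of the template. -/
def crossingBound (s R n : ℕ) : ℕ := R + (s + 1) * ((n + s + 1) ^ (s + 2) * R) + 1

/-- The size of the set discarded in `exists_split`. -/
def splitBound (τ s R n : ℕ) : ℕ :=
  (τ * (n * n * R) + 1) * (τ + 1) + (n + (τ * (n * n * R) + 1) * τ) ^ (s + 2) * R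

/-- The number of neighbours that a vertex of the peeled set may have outside it. Here `t` is the
size of the parts of the template and `N i` is the size of a set that forces a stable set of size
`i`. -/
def peelDegree (τ s R t : ℕ) (N : ℕ → ℕ) : ℕ :=
  (τ * t) ^ (s + 2) * R + N t + τ * (τ * τ) * crossingBound s R (τ * t) +
    splitBound τ s R (τ * t) + R + (N t + N ((t + 1) ^ (s + 2) * R + N t + 1))

/-- The vertices of `Z` that have `i` and `j` but not `l` in their traces. -/
noncomputable def crossing (G : SimpleGraph V) (s r : ℕ) (I : Finset ℕ) (X : ℕ → Finset V)
    (Z : Finset V) (i j l : ℕ) : Finset V :=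
  Z.filter fun z => ¬ IsExc G s (I.biUnion X) z ∧ i ∈ trace G (r + s) I X z ∧
    j ∈ trace G (r + s) I X z ∧ l ∉ trace G (r + s) I X z

/-- Two vertices with crossing traces `J`, `J'` (that meet and do not contain one another) lie in
one of the sets of crossing vertices, which are discarded when small; and they are not both
large. -/
lemma Template.subset_or_subset_of_crossing {G : SimpleGraph V} {s r t R n : ℕ} {I : Finset ℕ}
    {X : ℕ → Finset V} {Z : Finset V} (hT : Template G r t I X) (hD : DoubleStarBdd G s R)
    (hRs : ForcesStable G R s) (hs : 0 < s) (ht : 4 * (s + 1) * (r + s) < t)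
    (hU : (I.biUnion X).card ≤ n) (x y : V)
    (hx : ∀ i ∈ I, ∀ j ∈ I, ∀ l ∈ I, i ∈ trace G (r + s) I X x → j ∈ trace G (r + s) I X x →
      l ∉ trace G (r + s) I X x → crossingBound s R n ≤ (crossing G s r I X Z i j l).card)
    (hy : ∀ i ∈ I, ∀ j ∈ I, ∀ l ∈ I, i ∈ trace G (r + s) I X y → j ∈ trace G (r + s) I X y →
      l ∉ trace G (r + s) I X y → crossingBound s R n ≤ (crossing G s r I X Z i j l).card)
    (hxy : ¬ Disjoint (trace G (r + s) I X x) (trace G (r + s) I X y)) :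
    trace G (r + s) I X x ⊆ trace G (r + s) I X y ∨
      trace G (r + s) I X y ⊆ trace G (r + s) I X x := by
  by_contra! hcon
  obtain ⟨i, hix, hiy⟩ := Finset.not_subset.1 hcon.1
  obtain ⟨l, hly, hlx⟩ := Finset.not_subset.1 hcon.2
  obtain ⟨j, hjx, hjy⟩ := Finset.not_disjoint_iff.1 hxy
  have hi := trace_subset _ _ _ _ _ hix
  have hj := trace_subset _ _ _ _ _ hjx
  have hl := trace_subset _ _ _ _ _ hly
  have h1 := hx i hi j hj l hl hix hjx hlx
  have h2 := hy j hj l hl i hi hjy hly hiy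
  have h3 := hT.card_crossing_le hD hRs hs ht hi hj hl (fun e => hiy (e ▸ hjy))
    (fun e => hlx (e ▸ hjx)) (fun e => hlx (e ▸ hix)) (A := crossing G s r I X Z i j l)
    (B := crossing G s r I X Z j l i)
    (fun z hz => (Finset.mem_filter.1 hz).2) (fun z hz => (Finset.mem_filter.1 hz).2)
    (by unfold crossingBound at h1; omega)
  have h4 : (s + 1) * (((I.biUnion X).card + s + 1) ^ (s + 2) * R) ≤
      (s + 1) * ((n + s + 1) ^ (s + 2) * R) := by gcongr
  unfold crossingBound at h2
  omega

/-- The structure theorem. Take a template that cannot be extended, and let `J(x)` be the trace of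
`x`. Apart from few vertices, the nonempty traces that occur form a laminar family. The vertices
with full trace receive few edges from those with a trace that is neither empty nor full, so the
latter are peeled off; they are divided according to whether the trace is contained in a fixed
maximal one, or disjoint from it. -/
theorem exists_peel {G : SimpleGraph V} {τ s R : ℕ} {N : ℕ → ℕ}
    (hτ : ∀ K : Finset V, G.IsClique (K : Set V) → K.card ≤ τ) (hD : DoubleStarBdd G s R)
    (hRs : ForcesStable G R s) (hs : 0 < s) (hN : ∀ t, ForcesStable G (N t) t)
    (Z : Finset V) (w : ℕ) (hne : Z.Nonempty) (hw2 : 2 ≤ w) (hwτ : w ≤ τ)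
    (hZ : CliqueBdd G Z w) :
    ∃ (A B : Finset V) (a b : ℕ), A ⊆ Z ∧ B ⊆ Z ∧ (A ∪ B).Nonempty ∧ CliqueBdd G A a ∧
      CliqueBdd G B b ∧ a < w ∧ b < w ∧ a + b ≤ w ∧
      ∀ v ∈ A ∪ B, (hits G v (Z \ (A ∪ B))).card ≤
        peelDegree τ s R (doubleStarPart τ s) N := by
  set t := doubleStarPart τ s with ht
  set n := τ * t with hn
  by_cases hdeg : ∀ v ∈ Z, peelDegree τ s R t N < (hits G v Z).card
  swap
  · -- a single vertex of small degree can be peeled off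
    push Not at hdeg
    obtain ⟨v, hv, hvd⟩ := hdeg
    refine ⟨{v}, ∅, 1, 0, by simpa using hv, by simp, by simp, fun K hK _ => ?_, fun K hK _ => ?_,
      by omega, by omega, by omega, fun u hu => ?_⟩
    · simpa using Finset.card_le_card hK
    · simpa using Finset.card_le_card hK
    · obtain rfl : u = v := by simpa using hu
      exact (Finset.card_le_card (Finset.filter_subset_filter _ Finset.sdiff_subset)).trans hvd
  -- a template with at least two parts that cannot be extended
  obtain ⟨k, hk2, hkτ, ⟨I, X, hT, hIk, hXZ⟩, hmax⟩ := exists_maximal_template (Z := Z) (s := s)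
      (t := t) (a := 2) hτ (by
        rw [ht, doubleStarPart]
        exact Nat.lt_succ_of_le (Nat.mul_le_mul_right _ (by omega))) (by omega) (by
      obtain ⟨P, hP, Q, hQ, ⟨hPc, hPi⟩, ⟨hQc, hQi⟩, hPQ⟩ := exists_pair_of_degree hD hN
        (by rw [ht, doubleStarPart]; omega : 0 < t) hne fun v hv => by
          have := hdeg v hv
          unfold peelDegree at this
          omega
      refine ⟨_, _, (template_singleton (n := 0) (r := 2 * s) hPc hPi).snoc (n := 1)
        (by simp) hQc hQi (fun i _ x hx => (hPQ x hx).trans (by omega)), by simp, fun i hi => ?_⟩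
      rcases Finset.mem_insert.1 hi with rfl | hi
      · simpa using hQ
      · rw [Finset.mem_singleton] at hi
        subst hi
        simpa using hP)
  set U := I.biUnion X with hU
  have hUc : U.card ≤ n :=
    (Finset.card_biUnion_le_card_mul I X t fun i hi => (hT.card_eq i hi).le).trans
      (Nat.mul_le_mul_right t (hIk.le.trans hkτ))
  have hks : (k + 1) * s = k * s + s := by ring
  have hρ : k * s + s ≤ (τ + 1) * s := by
    rw [← hks]; exact Nat.mul_le_mul_right s (by omega)
  have htlt : ∀ c ≤ 4 * (s + 1) + τ + 1, c * (k * s + s) < t := fun c hc => by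
    rw [ht, doubleStarPart]
    exact Nat.lt_succ_of_le (Nat.mul_le_mul hc hρ)
  have ht0 : (s + 2) * (k * s) < t :=
    (Nat.mul_le_mul_left _ (Nat.le_add_right _ _)).trans_lt (htlt (s + 2) (by omega))
  have hIne : I.Nonempty := Finset.card_pos.1 (by omega)
  set m := I.max' hIne with hm
  have hmI : m ∈ I := Finset.max'_mem I hIne
  have hlast : ∀ i ∈ I, i ≤ m := fun i hi => Finset.le_max' I i hi
  obtain ⟨i₀, hi₀, hi₀m⟩ : ∃ i ∈ I, i < m := by
    obtain ⟨i, hi, h⟩ := Finset.exists_mem_ne (by omega : 1 < I.card) m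
    exact ⟨i, hi, lt_of_le_of_ne (hlast i hi) h⟩
  set J : V → Finset ℕ := trace G (k * s + s) I X with hJ
  -- the exceptional vertices, and those with empty trace
  set E := Z.filter fun x => IsExc G s U x with hE
  have hEc : E.card ≤ n ^ (s + 2) * R :=
    (card_le_of_isHalf hD U E fun y hy => (Finset.mem_filter.1 hy).2).trans
      (Nat.mul_le_mul_right R (Nat.pow_le_pow_left hUc _))
  set O := Z.filter fun x => J x = ∅ with hO
  have hOc : O.card ≤ N t := by
    by_contra! hlt
    obtain ⟨Q, hQ, hQc, hQi⟩ := hN t O hlt.le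
    have hIn : ∀ i ∈ I, i < m + 1 := fun i hi => Nat.lt_succ_of_le (hlast i hi)
    refine hmax ⟨_, _, (hT.mono (by omega : k * s ≤ (k + 1) * s) subset_rfl).snoc hIn hQc hQi
      fun i hi x hx => ?_, ?_, fun i hi => ?_⟩
    · have h1 := (Finset.mem_filter.1 (hQ hx)).2
      have h2 := misses_lt_of_notMem_trace (G := G) (ρ := k * s + s) (x := x) hi
        (by rw [show trace G (k * s + s) I X x = ∅ from h1]; simp)
      omega
    · rw [Finset.card_insert_of_notMem fun h => (hIn _ h).false, hIk]
    · rcases Finset.mem_insert.1 hi with rfl | hi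
      · simpa using hQ.trans (Finset.filter_subset _ _)
      · rw [Function.update_of_ne (hIn i hi).ne]
        exact hXZ i hi
  -- the small sets of vertices with crossing traces
  set cross : ℕ × ℕ × ℕ → Finset V := fun c => crossing G s (k * s) I X Z c.1 c.2.1 c.2.2
    with hcross
  set D := ((I ×ˢ I ×ˢ I).filter fun c => (cross c).card < crossingBound s R n).biUnion cross
    with hDd
  have hDc : D.card ≤ τ * (τ * τ) * crossingBound s R n := by
    refine (Finset.card_biUnion_le_card_mul _ _ (crossingBound s R n) fun c hc =>
      (Finset.mem_filter.1 hc).2.le).trans (Nat.mul_le_mul_right _ ?_)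
    refine (Finset.card_filter_le _ _).trans ?_
    rw [Finset.card_product, Finset.card_product, hIk]
    exact Nat.mul_le_mul hkτ (Nat.mul_le_mul hkτ hkτ)
  have hcb : ∀ x ∈ Z, ¬ IsExc G s U x → x ∉ D → ∀ i ∈ I, ∀ j ∈ I, ∀ l ∈ I, i ∈ J x → j ∈ J x →
      l ∉ J x → crossingBound s R n ≤ (cross (i, j, l)).card := by
    intro x hxZ hxe hxD i hi j hj l hl hix hjx hlx
    by_contra! hlt
    exact hxD (Finset.mem_biUnion.2 ⟨(i, j, l), Finset.mem_filter.2
      ⟨by simp [hi, hj, hl], hlt⟩, Finset.mem_filter.2 ⟨hxZ, hxe, hix, hjx, hlx⟩⟩)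
  set Y := Z.filter fun x => ¬ IsExc G s U x ∧ J x ≠ ∅ ∧ J x ≠ I ∧ x ∉ D with hY
  have hlam : ∀ x ∈ Y, ∀ y ∈ Y, ¬ Disjoint (J x) (J y) → J x ⊆ J y ∨ J y ⊆ J x := by
    intro x hx y hy hxy
    rw [Finset.mem_filter] at hx hy
    exact hT.subset_or_subset_of_crossing hD hRs hs (htlt _ (by omega)) hUc x y
      (hcb x hx.1 hx.2.1 hx.2.2.2.2) (hcb y hy.1 hy.2.1 hy.2.2.2.2) hxy
  have hclass : ∀ y ∈ Z, y ∉ E → y ∉ O → y ∉ D → J y ≠ I → y ∈ Y := by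
    intro y hyZ hyE hyO hyD hyI
    exact Finset.mem_filter.2 ⟨hyZ, fun h => hyE (Finset.mem_filter.2 ⟨hyZ, h⟩),
      fun h => hyO (Finset.mem_filter.2 ⟨hyZ, h⟩), hyI, hyD⟩
  -- a vertex of the last part has no neighbours with full trace, so `Y` is large
  have hYc : splitBound τ s R n < Y.card := by
    obtain ⟨p, hp⟩ := Finset.card_pos.1 ((by rw [ht, doubleStarPart]; omega : 0 < t).trans_eq
      (hT.card_eq m hmI).symm)
    have hsub : hits G p Z ⊆ E ∪ O ∪ D ∪ Y := by
      intro y hy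
      rw [mem_hits] at hy
      by_contra hcon
      simp only [Finset.mem_union, not_or] at hcon
      obtain ⟨⟨⟨hyE, hyO⟩, hyD⟩, hyY⟩ := hcon
      have hyI : trace G (k * s + s) I X y = I := by
        by_contra h
        exact hyY (hclass y hy.1 hyE hyO hyD h)
      exact hT.not_adj_of_lt hs ht0 (fun h => hyE (Finset.mem_filter.2 ⟨hy.1, h⟩))
        (by rwa [hyI]) (by rwa [hyI]) hi₀m hp hy.2.symm
    have h1 := Finset.card_le_card hsub
    have h2 := Finset.card_union_le (E ∪ O ∪ D) Y
    have h3 := Finset.card_union_le (E ∪ O) D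
    have h4 := Finset.card_union_le E O
    have h5 := hdeg p (hXZ m hmI hp)
    unfold peelDegree at h5
    rw [← hn] at h5
    omega
  obtain ⟨x₁, hx₁, hx₁max⟩ := Finset.exists_max_image Y (fun x => (J x).card)
    (Finset.card_pos.1 (by omega))
  set A := Y.filter fun x => J x ⊆ J x₁ with hA
  set B := Y.filter fun x => Disjoint (J x) (J x₁) with hB
  have hYZ : Y ⊆ Z := Finset.filter_subset _ _
  have hAY : A ⊆ Y := Finset.filter_subset _ _
  have hBY : B ⊆ Y := Finset.filter_subset _ _
  have hYAB : ∀ x ∈ Y, x ∈ A ∨ x ∈ B := by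
    intro x hx
    by_cases hd : Disjoint (J x) (J x₁)
    · exact Or.inr (Finset.mem_filter.2 ⟨hx, hd⟩)
    · refine Or.inl (Finset.mem_filter.2 ⟨hx, ?_⟩)
      rcases hlam x hx x₁ hx₁ hd with h | h
      · exact h
      · exact (Finset.eq_of_subset_of_card_le h (hx₁max x hx)).ge
  obtain ⟨C, a, b, hCc, hCa, hCb, hab⟩ := exists_split (n := n) (τ := τ) hD hRs hUc hZ hwτ
    (hAY.trans hYZ) (hBY.trans hYZ) fun x hx y hy => by
      have hx' := Finset.mem_filter.1 (hAY hx)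
      have hy' := Finset.mem_filter.1 (hBY hy)
      exact hT.exists_separating_edge hs (htlt 2 (by omega)) hx'.2.1 hy'.2.1
        (Finset.nonempty_iff_ne_empty.2 hx'.2.2.1) (Finset.nonempty_iff_ne_empty.2 hy'.2.2.1)
        ((Finset.mem_filter.1 hy).2.symm.mono_left (Finset.mem_filter.1 hx).2)
  have hx₁' := Finset.mem_filter.1 hx₁
  have hAw : CliqueBdd G A (w - 1) := by
    obtain ⟨i, hi, hix⟩ : ∃ i ∈ I, i ∉ J x₁ := by
      by_contra! h
      exact hx₁'.2.2.2.1 (Finset.Subset.antisymm (trace_subset _ _ _ _ _) h)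
    exact hT.cliqueBdd_of_near hZ (hAY.trans hYZ) hi (hXZ i hi) hwτ (htlt τ (by omega))
      fun x hx => (misses_lt_of_notMem_trace hi fun h => hix ((Finset.mem_filter.1 hx).2 h)).le
  have hBw : CliqueBdd G B (w - 1) := by
    obtain ⟨j, hj⟩ := Finset.nonempty_iff_ne_empty.2 hx₁'.2.2.1
    have hjI : j ∈ I := trace_subset _ _ _ _ _ hj
    exact hT.cliqueBdd_of_near hZ (hBY.trans hYZ) hjI (hXZ j hjI) hwτ (htlt τ (by omega))
      fun x hx => (misses_lt_of_notMem_trace hjI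
        (Finset.disjoint_right.1 (Finset.mem_filter.1 hx).2 hj)).le
  have hmin : ∀ {A' : Finset V} {a' : ℕ}, CliqueBdd G A' (w - 1) → CliqueBdd G (A' \ C) a' →
      CliqueBdd G (A' \ C) (min a' (w - 1)) := fun h h' K hK hKc =>
    le_min (h' K hK hKc) (h K (hK.trans Finset.sdiff_subset) hKc)
  refine ⟨A \ C, B \ C, min a (w - 1), min b (w - 1),
    Finset.sdiff_subset.trans (hAY.trans hYZ), Finset.sdiff_subset.trans (hBY.trans hYZ), ?_,
    hmin hAw hCa, hmin hBw hCb, by omega, by omega, by omega, fun v hv => ?_⟩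
  · obtain ⟨x, hx, hxC⟩ := Finset.exists_mem_notMem_of_card_lt_card (hCc.trans_lt hYc)
    refine ⟨x, ?_⟩
    rw [← Finset.union_sdiff_distrib]
    exact Finset.mem_sdiff.2 ⟨Finset.mem_union.2 (hYAB x hx), hxC⟩
  · rw [← Finset.union_sdiff_distrib] at hv ⊢
    have hvY : v ∈ Y := Finset.union_subset hAY hBY (Finset.mem_sdiff.1 hv).1
    have hv' := Finset.mem_filter.1 hvY
    set F := (hits G v Z).filter fun y => ¬ IsExc G s U y ∧ J y = I with hF
    have hFc : F.card < R := hT.card_full_trace_lt hD hs (htlt (s + 2) (by omega)) hmI hlast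
      (Finset.nonempty_iff_ne_empty.2 hv'.2.2.1) hv'.2.2.2.1 fun y hy => by
        rw [Finset.mem_filter, mem_hits] at hy
        exact ⟨hy.1.2, hy.2⟩
    have hsub : hits G v (Z \ ((A ∪ B) \ C)) ⊆ E ∪ O ∪ D ∪ C ∪ F := by
      intro y hy
      rw [mem_hits, Finset.mem_sdiff, Finset.mem_sdiff] at hy
      by_contra hcon
      simp only [Finset.mem_union, not_or] at hcon
      obtain ⟨⟨⟨⟨hyE, hyO⟩, hyD⟩, hyC⟩, hyF⟩ := hcon
      have hyY := hclass y hy.1.1 hyE hyO hyD fun h => hyF (Finset.mem_filter.2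
        ⟨mem_hits.2 ⟨hy.1.1, hy.2⟩, fun h' => hyE (Finset.mem_filter.2 ⟨hy.1.1, h'⟩), h⟩)
      exact hy.1.2 ⟨Finset.mem_union.2 (hYAB y hyY), hyC⟩
    have h1 := Finset.card_le_card hsub
    have h2 := Finset.card_union_le (E ∪ O ∪ D ∪ C) F
    have h3 := Finset.card_union_le (E ∪ O ∪ D) C
    have h4 := Finset.card_union_le (E ∪ O) D
    have h5 := Finset.card_union_le E O
    have h6 : C.card ≤ splitBound τ s R n := hCc
    unfold peelDegree
    rw [← hn]
    omega

end Peeling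

/-! ### Polynomial bounds -/

section PolynomialBounds

/-- The function `g` is bounded above by a polynomial with natural coefficients. -/
def PolyBdd (g : ℕ → ℕ) : Prop := ∃ f : Polynomial ℕ, ∀ x, g x ≤ f.eval x

lemma PolyBdd.const (c : ℕ) : PolyBdd fun _ => c := ⟨Polynomial.C c, by simp⟩

lemma PolyBdd.id : PolyBdd fun x => x := ⟨Polynomial.X, by simp⟩

lemma PolyBdd.add {g h : ℕ → ℕ} (hg : PolyBdd g) (hh : PolyBdd h) :
    PolyBdd fun x => g x + h x := by
  obtain ⟨a, ha⟩ := hg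
  obtain ⟨b, hb⟩ := hh
  exact ⟨a + b, fun x => by simpa using Nat.add_le_add (ha x) (hb x)⟩

lemma PolyBdd.mul {g h : ℕ → ℕ} (hg : PolyBdd g) (hh : PolyBdd h) :
    PolyBdd fun x => g x * h x := by
  obtain ⟨a, ha⟩ := hg
  obtain ⟨b, hb⟩ := hh
  exact ⟨a * b, fun x => by simpa using Nat.mul_le_mul (ha x) (hb x)⟩

lemma PolyBdd.pow {g : ℕ → ℕ} (hg : PolyBdd g) (n : ℕ) : PolyBdd fun x => g x ^ n := by
  obtain ⟨a, ha⟩ := hg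
  exact ⟨a ^ n, fun x => by simpa using Nat.pow_le_pow_left (ha x) n⟩

lemma polyBdd_ram (s : ℕ) : PolyBdd fun τ => ram τ s := by
  induction s with
  | zero => exact PolyBdd.const 0
  | succ s ih => exact (PolyBdd.id.mul (ih.add (PolyBdd.const 1))).add (PolyBdd.const 1)

lemma PolyBdd.starStableBound (s : ℕ) {F t : ℕ → ℕ} (hF : PolyBdd F) (ht : PolyBdd t) :
    PolyBdd fun τ => starStableBound τ s (F τ) (t τ) := by
  unfold PolyChi.starStableBound
  repeat' first
    | exact PolyBdd.const _ | exact PolyBdd.id | exact polyBdd_ram s | exact hF | exact ht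
    | apply PolyBdd.add | apply PolyBdd.mul | apply PolyBdd.pow

lemma polyBdd_starPart (s : ℕ) : PolyBdd fun τ => starPart τ s := by
  unfold starPart
  repeat' first
    | exact PolyBdd.const _ | exact PolyBdd.id | apply PolyBdd.add | apply PolyBdd.mul

lemma PolyBdd.starColours (s : ℕ) {F : ℕ → ℕ} (hF : PolyBdd F) :
    PolyBdd fun τ => starColours τ s (F τ) := by
  have h1 := polyBdd_starPart s
  have h2 := PolyBdd.starStableBound s hF h1
  unfold PolyChi.starColours
  repeat' first
    | exact PolyBdd.const _ | exact PolyBdd.id | exact h1 | exact h2 | exact hF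
    | apply PolyBdd.add | apply PolyBdd.mul | apply PolyBdd.pow

lemma PolyBdd.doubleStarStableBound (s : ℕ) {R t : ℕ → ℕ} (hR : PolyBdd R) (ht : PolyBdd t) :
    PolyBdd fun τ => doubleStarStableBound τ s (R τ) (t τ) := by
  unfold PolyChi.doubleStarStableBound
  repeat' first
    | exact PolyBdd.const _ | exact PolyBdd.id | exact hR | exact ht
    | apply PolyBdd.add | apply PolyBdd.mul | apply PolyBdd.pow

lemma polyBdd_doubleStarPart (s : ℕ) : PolyBdd fun τ => doubleStarPart τ s := by
  unfold doubleStarPart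
  repeat' first
    | exact PolyBdd.const _ | exact PolyBdd.id | apply PolyBdd.add | apply PolyBdd.mul

lemma PolyBdd.crossingBound (s : ℕ) {R n : ℕ → ℕ} (hR : PolyBdd R) (hn : PolyBdd n) :
    PolyBdd fun τ => crossingBound s (R τ) (n τ) := by
  unfold PolyChi.crossingBound
  exact (hR.add ((PolyBdd.const _).mul ((((hn.add (.const s)).add (.const 1)).pow (s + 2)).mul
    hR))).add (.const 1)

lemma PolyBdd.splitBound (s : ℕ) {R n : ℕ → ℕ} (hR : PolyBdd R) (hn : PolyBdd n) :
    PolyBdd fun τ => splitBound τ s (R τ) (n τ) := by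
  unfold PolyChi.splitBound
  have h := (PolyBdd.id.mul ((hn.mul hn).mul hR)).add (.const 1)
  exact (h.mul (PolyBdd.id.add (.const 1))).add (((hn.add (h.mul .id)).pow (s + 2)).mul hR)

lemma PolyBdd.peelDegree (s : ℕ) {R t : ℕ → ℕ} {N : ℕ → ℕ → ℕ} (hR : PolyBdd R)
    (ht : PolyBdd t) (hN : ∀ {g : ℕ → ℕ}, PolyBdd g → PolyBdd fun τ => N τ (g τ)) :
    PolyBdd fun τ => peelDegree τ s (R τ) (t τ) (N τ) := by
  unfold PolyChi.peelDegree
  have hn := PolyBdd.id.mul ht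
  have hNt := hN ht
  have h := (((ht.add (.const 1)).pow (s + 2)).mul hR).add hNt |>.add (.const 1)
  exact (((((hn.pow (s + 2)).mul hR).add hNt).add
    ((PolyBdd.id.mul (PolyBdd.id.mul .id)).mul (.crossingBound s hR hn))).add
    (.splitBound s hR hn)).add hR |>.add (hNt.add (hN h))

lemma eval_mono (f : Polynomial ℕ) : Monotone fun x => f.eval x := by
  intro x y h
  simp only [Polynomial.eval_eq_sum_range]
  gcongr

end PolynomialBounds

/-! ### Double stars and disjoint unions with stars -/

section Graphs
open Classical

/-- The star with `s` leaves; its centre is `none`. -/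
def starGraph (s : ℕ) : SimpleGraph (Option (Fin s)) where
  Adj x y := (x = none ∧ y ≠ none) ∨ (x ≠ none ∧ y = none)
  symm := ⟨by tauto⟩
  loopless := ⟨by tauto⟩

/-- The disjoint union of `m` stars with `s` leaves each. -/
def starForest (m s : ℕ) : SimpleGraph (Fin m × Option (Fin s)) where
  Adj x y := x.1 = y.1 ∧ (starGraph s).Adj x.2 y.2
  symm := ⟨fun _ _ h => ⟨h.1.symm, h.2.symm⟩⟩
  loopless := ⟨fun _ h => (starGraph s).irrefl h.2⟩

/-- The double star with `s` leaves at either internal vertex; the internal vertices are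
`(false, none)` and `(true, none)`. -/
def doubleStar (s : ℕ) : SimpleGraph (Bool × Option (Fin s)) where
  Adj x y := (x.1 ≠ y.1 ∧ x.2 = none ∧ y.2 = none) ∨ (x.1 = y.1 ∧ (starGraph s).Adj x.2 y.2)
  symm := ⟨fun _ _ h => h.imp (fun h => ⟨h.1.symm, h.2.2, h.2.1⟩) fun h => ⟨h.1.symm, h.2.symm⟩⟩
  loopless := ⟨fun _ h => h.elim (fun h => h.1 rfl) fun h => (starGraph s).irrefl h.2⟩

variable {V : Type*}

lemma colorable_of_colBdd [Fintype V] {G : SimpleGraph V} {n : ℕ}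
    (h : ColBdd G Finset.univ n) : G.Colorable n := by
  obtain ⟨c, h1, h2⟩ := h
  exact ⟨SimpleGraph.Coloring.mk (fun v => (⟨c v, h1 v (Finset.mem_univ v)⟩ : Fin n))
    fun {u v} huv e => h2 u (Finset.mem_univ u) v (Finset.mem_univ v) huv (by simpa using e)⟩

lemma colBdd_of_colorable_induce {G : SimpleGraph V} {T : Finset V} {n : ℕ}
    (h : (G.induce (T : Set V)).Colorable n) : ColBdd G T n := by
  obtain ⟨c⟩ := h
  refine ⟨fun v => if hv : v ∈ T then (c ⟨v, hv⟩ : ℕ) else 0, fun v hv => ?_,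
    fun u hu v hv huv e => ?_⟩
  · simp [hv]
  · simp only [hu, hv, dif_pos] at e
    exact c.valid (v := ⟨u, hu⟩) (w := ⟨v, hv⟩) huv (Fin.ext e)

lemma isHFree_mono {W₁ W₂ : Type*} {H₁ : SimpleGraph W₁} {H₂ : SimpleGraph W₂}
    (h : H₁.IsIndContained H₂) {G : SimpleGraph V} (hG : IsHFree H₁ G) : IsHFree H₂ G :=
  fun h' => hG (h.trans h')

lemma SatisfiesEsperet.mono {W₁ : Type u₁} {W₂ : Type u₂} {H₁ : SimpleGraph W₁}
    {H₂ : SimpleGraph W₂} (h : H₁.IsIndContained H₂) (h₂ : SatisfiesEsperet.{u₂, w} H₂) :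
    SatisfiesEsperet.{u₁, w} H₁ := by
  obtain ⟨f, hf⟩ := h₂
  exact ⟨f, fun V _ G hG => hf V G (isHFree_mono h hG)⟩

/-- It suffices to bound the number of colours by a polynomial function of the clique number. -/
lemma satisfiesEsperet_of_colBdd {W : Type u} {H : SimpleGraph W} {g : ℕ → ℕ} (hg : PolyBdd g)
    (h : ∀ (V : Type w) [Fintype V] (G : SimpleGraph V), IsHFree H G →
      (∀ K : Finset V, G.IsClique (K : Set V) → K.card ≤ G.cliqueNum) →
      ColBdd G Finset.univ (g G.cliqueNum)) : SatisfiesEsperet.{u, w} H := by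
  obtain ⟨f, hf⟩ := hg
  refine ⟨f, fun V _ G hG => ?_⟩
  have := Fintype.ofFinite V
  exact SimpleGraph.chromaticNumber_le_iff_colorable.2 (colorable_of_colBdd
    ((h V G hG fun K hK => hK.card_le_cliqueNum).mono subset_rfl (hf _)))

lemma isIndContained_of_map {W : Type*} {H : SimpleGraph W} {G : SimpleGraph V} (f : W → V)
    (hf : Function.Injective f) (h : ∀ x y, G.Adj (f x) (f y) ↔ H.Adj x y) :
    H.IsIndContained G := ⟨⟨⟨f, hf⟩, fun {x y} => h x y⟩⟩

lemma doubleStarBdd_of_isHFree {G : SimpleGraph V} {s R : ℕ} (hs : 0 < s)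
    (hR : ForcesStable G R s) (hG : IsHFree (doubleStar s) G) : DoubleStarBdd G s R := by
  intro u v S T huv hSc hSi hS hT
  by_contra! hle
  obtain ⟨T', hT', hTc, hTi⟩ := hR T hle
  replace hT : ∀ y ∈ T', G.Adj v y ∧ ¬ G.Adj u y ∧ ∀ x ∈ S, ¬ G.Adj x y :=
    fun y hy => hT y (hT' hy)
  obtain ⟨x₀, hx₀⟩ := Finset.card_pos.1 (hs.trans_eq hSc.symm)
  obtain ⟨y₀, hy₀⟩ := Finset.card_pos.1 (hs.trans_eq hTc.symm)
  set a := (S.equivFinOfCardEq hSc).symm with ha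
  set b := (T'.equivFinOfCardEq hTc).symm with hb
  have hne1 : ∀ i, u ≠ a i := fun i e => G.irrefl (e ▸ (hS _ (a i).2).1)
  have hne2 : ∀ i, v ≠ b i := fun i e => G.irrefl (e ▸ (hT _ (b i).2).1)
  have hne3 : ∀ i, v ≠ a i := fun i e =>
    (hT y₀ hy₀).2.2 _ (a i).2 (e ▸ (hT y₀ hy₀).1)
  have hne4 : ∀ i, u ≠ b i := fun i e =>
    (hT _ (b i).2).2.2 x₀ hx₀ (e ▸ (hS x₀ hx₀).1.symm)
  have hne5 : ∀ i j, (a i : V) ≠ b j := fun i j e =>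
    (hS _ (a i).2).2 (e ▸ (hT _ (b j).2).1)
  have ha0 : ∀ i j, ¬ G.Adj (a i : V) (a j) := fun i j =>
    not_adj_of_isIndepSet hSi (a i).2 (a j).2
  have hb0 : ∀ i j, ¬ G.Adj (b i : V) (b j) := fun i j =>
    not_adj_of_isIndepSet hTi (b i).2 (b j).2
  have hua : ∀ i, G.Adj u (a i) := fun i => (hS _ (a i).2).1
  have hva : ∀ i, ¬ G.Adj v (a i) := fun i => (hS _ (a i).2).2
  have hvb : ∀ i, G.Adj v (b i) := fun i => (hT _ (b i).2).1
  have hub : ∀ i, ¬ G.Adj u (b i) := fun i => (hT _ (b i).2).2.1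
  have hab : ∀ i j, ¬ G.Adj (a i : V) (b j) := fun i j => (hT _ (b j).2).2.2 _ (a i).2
  refine hG (isIndContained_of_map (fun p : Bool × Option (Fin s) => match p with
    | (false, none) => u
    | (true, none) => v
    | (false, some i) => a i
    | (true, some i) => b i) ?_ ?_)
  · rintro ⟨_ | _, _ | i⟩ ⟨_ | _, _ | j⟩ h <;> simp only at h
    all_goals first
      | rfl
      | exact absurd h huv.ne
      | exact absurd h huv.ne'
      | exact absurd h (hne1 _) | exact absurd h.symm (hne1 _)
      | exact absurd h (hne2 _) | exact absurd h.symm (hne2 _)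
      | exact absurd h (hne3 _) | exact absurd h.symm (hne3 _)
      | exact absurd h (hne4 _) | exact absurd h.symm (hne4 _)
      | exact absurd h (hne5 _ _) | exact absurd h.symm (hne5 _ _)
      | rw [a.injective (Subtype.ext h)]
      | rw [b.injective (Subtype.ext h)]
  · rintro ⟨_ | _, _ | i⟩ ⟨_ | _, _ | j⟩ <;>
      simp [doubleStar, starGraph, huv, huv.symm, ha0, hb0, hua, hva, hvb, hub, hab,
        G.adj_comm (a _ : V) u, G.adj_comm (a _ : V) v, G.adj_comm (b _ : V) u,
        G.adj_comm (b _ : V) v, G.adj_comm (b _ : V) (a _)]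

/-- Double stars satisfy Esperet's conjecture. -/
theorem satisfiesEsperet_doubleStar {s : ℕ} (hs : 0 < s) :
    SatisfiesEsperet.{0, w} (doubleStar s) := by
  refine satisfiesEsperet_of_colBdd (g := fun τ => τ * (τ * peelDegree τ s (ram τ s)
    (doubleStarPart τ s) (doubleStarStableBound τ s (ram τ s)) + 1))
    (PolyBdd.id.mul ((PolyBdd.id.mul (PolyBdd.peelDegree s (polyBdd_ram s)
      (polyBdd_doubleStarPart s) fun h => PolyBdd.doubleStarStableBound s (polyBdd_ram s) h)).add
      (PolyBdd.const 1)))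
    fun V _ G hG hτ => ?_
  have hRs := forcesStable_ram hτ s
  have hD := doubleStarBdd_of_isHFree hs hRs hG
  have hR : 0 < ram G.cliqueNum s := by
    obtain ⟨s, rfl⟩ := Nat.exists_eq_succ_of_ne_zero hs.ne'
    exact Nat.succ_pos _
  exact colBdd_of_peel (fun Z w hne hw2 hwτ hZ => exists_peel hτ hD hRs hs
    (fun t => forcesStable_of_doubleStarBdd hτ hRs hs hR hD) Z w hne hw2 hwτ hZ) _
    fun K _ hK => hτ K hK

/-- If `G` does not contain the disjoint union of `H` and a star, then the sets anticomplete to a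
star induce `H`-free subgraphs. -/
lemma starAntiBdd_of_isHFree {W : Type u} {H : SimpleGraph W} {V : Type w} [Fintype V]
    {G : SimpleGraph V} {s : ℕ} (hs : 0 < s) {f : Polynomial ℕ}
    (hf : ∀ (V : Type w) [Finite V] (G : SimpleGraph V),
      IsHFree H G → G.chromaticNumber ≤ ((f.eval G.cliqueNum : ℕ) : ℕ∞))
    (hG : IsHFree (H ⊕g starGraph s) G) : StarAntiBdd G s (f.eval G.cliqueNum) := by
  intro c S T hSc hSi hS hT
  have hfree : IsHFree H (G.induce (T : Set V)) := by
    rintro ⟨g⟩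
    set a := (S.equivFinOfCardEq hSc).symm with ha
    have hca : ∀ i, G.Adj c (a i) := fun i => hS _ (a i).2
    have ha0 : ∀ i j, ¬ G.Adj (a i : V) (a j) := fun i j =>
      not_adj_of_isIndepSet hSi (a i).2 (a j).2
    have hcg : ∀ x, ¬ G.Adj c (g x) := fun x => (hT _ (g x).2).1
    have hag : ∀ i x, ¬ G.Adj (a i : V) (g x) := fun i x => (hT _ (g x).2).2 _ (a i).2
    have hcne : ∀ x, c ≠ g x := fun x e => hag ⟨0, hs⟩ x (e ▸ (hca ⟨0, hs⟩).symm)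
    have hane : ∀ i x, (a i : V) ≠ g x := fun i x e => hcg x (e ▸ hca i)
    refine hG (isIndContained_of_map (fun p : W ⊕ Option (Fin s) => match p with
      | Sum.inl x => (g x : V)
      | Sum.inr none => c
      | Sum.inr (some i) => a i) ?_ ?_)
    · rintro (x | _ | i) (y | _ | j) h <;> simp only at h
      all_goals first
        | rfl
        | rw [g.injective (Subtype.ext h)]
        | exact absurd h (hcne _) | exact absurd h.symm (hcne _)
        | exact absurd h (hane _ _) | exact absurd h.symm (hane _ _)
        | exact absurd h (hca _).ne | exact absurd h.symm (hca _).ne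
        | rw [a.injective (Subtype.ext h)]
    · have hgg : ∀ x y, G.Adj (g x : V) (g y) ↔ H.Adj x y := fun x y => g.map_rel_iff
      rintro (x | _ | i) (y | _ | j) <;>
        simp [starGraph, hgg, hca, ha0, hcg, hag, G.adj_comm (g _ : V) c,
          G.adj_comm (g _ : V) (a _), G.adj_comm (a _ : V) c]
  refine colBdd_of_colorable_induce (SimpleGraph.chromaticNumber_le_iff_colorable.1
    ((hf _ (G.induce (T : Set V)) hfree).trans ?_))
  exact_mod_cast eval_mono f (SimpleGraph.cliqueNum_induce_le _)

/-- Esperet's conjecture is preserved by adding a disjoint star. -/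
theorem SatisfiesEsperet.sum_star {W : Type u} {H : SimpleGraph W}
    (hH : SatisfiesEsperet.{u, w} H) {s : ℕ} (hs : 0 < s) :
    SatisfiesEsperet.{u, w} (H ⊕g starGraph s) := by
  obtain ⟨f, hf⟩ := hH
  exact satisfiesEsperet_of_colBdd (PolyBdd.starColours s ⟨f, fun _ => le_rfl⟩)
    fun V _ G hG hτ => colBdd_of_starAntiBdd hτ (starAntiBdd_of_isHFree hs hf hG) _

theorem SatisfiesEsperet.sum_starForest {W : Type u} {H : SimpleGraph W}
    (hH : SatisfiesEsperet.{u, w} H) {s : ℕ} (hs : 0 < s) (m : ℕ) :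
    SatisfiesEsperet.{u, w} (H ⊕g starForest m s) := by
  induction m with
  | zero =>
    refine hH.mono (isIndContained_of_map (fun p : W ⊕ Fin 0 × Option (Fin s) => match p with
      | Sum.inl x => x
      | Sum.inr q => q.1.elim0) ?_ ?_)
    · rintro (x | ⟨i, _⟩) (y | ⟨j, _⟩) h
      · exact congrArg _ h
      · exact j.elim0
      · exact i.elim0
      · exact i.elim0
    · rintro (x | ⟨i, _⟩) (y | ⟨j, _⟩)
      · simp
      · exact j.elim0
      · exact i.elim0
      · exact i.elim0
  | succ m ih =>
    refine (ih.sum_star hs).mono (isIndContained_of_map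
      (fun p : W ⊕ Fin (m + 1) × Option (Fin s) => match p with
        | Sum.inl x => Sum.inl (Sum.inl x)
        | Sum.inr (i, a) => if h : (i : ℕ) < m then Sum.inl (Sum.inr (⟨i, h⟩, a)) else Sum.inr a)
      ?_ ?_)
    · rintro (x | ⟨i, a⟩) (y | ⟨j, b⟩) h <;> simp only at h <;> (try split_ifs at h)
      all_goals first
        | (simp only [Sum.inl.injEq, Sum.inr.injEq, Prod.mk.injEq, Fin.mk.injEq, reduceCtorEq] at h)
      all_goals simp only [Sum.inl.injEq, Sum.inr.injEq, Prod.mk.injEq, Fin.ext_iff]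
      · exact h
      · exact h
      · exact ⟨by omega, h⟩
    · rintro (x | ⟨i, a⟩) (y | ⟨j, b⟩) <;> simp only <;> (try split_ifs) <;>
        simp [starForest, Fin.ext_iff] <;> omega

end Graphs

/-! ### Embedding arbitrary double stars and star-forests -/

section Shapes
open Classical

lemma mem_of_reachable {V : Type*} {G : SimpleGraph V} {C : Set V}
    (hC : ∀ x ∈ C, ∀ y, G.Adj x y → y ∈ C) {x y : V} (hx : x ∈ C) (h : G.Reachable x y) :
    y ∈ C := by
  obtain ⟨p⟩ := h
  induction p with
  | nil => exact hx
  | cons hadj _ ih => exact ih (hC _ hx _ hadj)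

/-- The two internal vertices of a double star are adjacent, and every other vertex is adjacent to
exactly one of them and to no other vertex: otherwise the graph would be disconnected or have a
further internal vertex. -/
lemma IsDoubleStar.exists_internal {W : Type*} {H : SimpleGraph W} (h : IsDoubleStar H) :
    ∃ u v, H.Adj u v ∧ ∀ x, x ≠ u → x ≠ v →
      (∀ y, H.Adj x y ↔ y = u) ∨ (∀ y, H.Adj x y ↔ y = v) := by
  obtain ⟨htree, hcard⟩ := h
  have hconn := htree.connected
  obtain ⟨u, v, huv, hint⟩ := Set.ncard_eq_two.1 hcard
  have hleaf : ∀ x, x ≠ u → x ≠ v → ∀ y z, H.Adj x y → H.Adj x z → y = z := by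
    intro x hxu hxv y z hy hz
    by_contra hne
    have : x ∈ internalVertices H := ⟨y, hy, z, hz, hne⟩
    rw [hint] at this
    rcases this with h | h
    · exact hxu h
    · exact hxv h
  have hadj : H.Adj u v := by
    by_contra hnadj
    have := mem_of_reachable (C := {x | x = u ∨ H.Adj u x}) (x := u) (y := v)
      (by
        rintro x (rfl | hx) y hy
        · exact Or.inr hy
        · have hxu : x ≠ u := hx.ne'
          have hxv : x ≠ v := fun e => hnadj (e ▸ hx)
          exact Or.inl (hleaf x hxu hxv y u hy hx.symm)) (Or.inl rfl) (hconn.preconnected u v)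
    rcases this with h | h
    · exact huv h.symm
    · exact hnadj h
  refine ⟨u, v, hadj, fun x hxu hxv => ?_⟩
  have := mem_of_reachable (C := {x | x = u ∨ x = v ∨ H.Adj u x ∨ H.Adj v x}) (x := u) (y := x)
    (by
      rintro y hy z hyz
      by_cases hyu : y = u
      · exact Or.inr (Or.inr (Or.inl (hyu ▸ hyz)))
      by_cases hyv : y = v
      · exact Or.inr (Or.inr (Or.inr (hyv ▸ hyz)))
      rcases hy with h | h | h | h
      · exact absurd h hyu
      · exact absurd h hyv
      · exact Or.inl (hleaf y hyu hyv z u hyz h.symm)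
      · exact Or.inr (Or.inl (hleaf y hyu hyv z v hyz h.symm)))
    (Or.inl rfl) (hconn.preconnected u x)
  rcases this with h | h | h | h
  · exact absurd h hxu
  · exact absurd h hxv
  · exact Or.inl fun y => ⟨fun hy => hleaf x hxu hxv y u hy h.symm, fun e => e ▸ h.symm⟩
  · exact Or.inr fun y => ⟨fun hy => hleaf x hxu hxv y v hy h.symm, fun e => e ▸ h.symm⟩

lemma IsDoubleStar.isIndContained {W : Type*} [Finite W] {H : SimpleGraph W}
    (h : IsDoubleStar H) {s : ℕ} (hs : Nat.card W ≤ s) : H.IsIndContained (doubleStar s) := by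
  obtain ⟨u, v, huv, hleaf⟩ := h.exists_internal
  set e : W → Fin s := fun x => Fin.castLE hs (Finite.equivFin W x) with he
  have hinj : Function.Injective e := fun x y hxy => by simpa [he] using hxy
  set f : W → Bool × Option (Fin s) := fun x =>
    if x = u then (false, none) else if x = v then (true, none) else
      if H.Adj x u then (false, some (e x)) else (true, some (e x)) with hf
  have hfu : f u = (false, none) := by simp [hf]
  have hfv : f v = (true, none) := by simp [hf, huv.ne']
  have hcase : ∀ x, x = u ∨ x = v ∨
      (f x = (false, some (e x)) ∧ x ≠ u ∧ x ≠ v ∧ ∀ y, H.Adj x y ↔ y = u) ∨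
      (f x = (true, some (e x)) ∧ x ≠ u ∧ x ≠ v ∧ ∀ y, H.Adj x y ↔ y = v) := by
    intro x
    by_cases hxu : x = u
    · exact Or.inl hxu
    by_cases hxv : x = v
    · exact Or.inr (Or.inl hxv)
    rcases hleaf x hxu hxv with h | h
    · exact Or.inr (Or.inr (Or.inl ⟨by simp [hf, hxu, hxv, h], hxu, hxv, h⟩))
    · exact Or.inr (Or.inr (Or.inr ⟨by simp [hf, hxu, hxv, h, huv.ne], hxu, hxv, h⟩))
  refine isIndContained_of_map f (fun x y hxy => ?_) fun x y => ?_
  · rcases hcase x with rfl | rfl | ⟨hx, -⟩ | ⟨hx, -⟩ <;>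
      rcases hcase y with rfl | rfl | ⟨hy, -⟩ | ⟨hy, -⟩
    all_goals first
      | rfl
      | (simp [hx, hy] at hxy; done)
      | (simp only [hx, hy, Prod.mk.injEq, Option.some.injEq, true_and] at hxy; exact hinj hxy)
      | simp [hfu, hfv, hx] at hxy
      | simp [hfu, hfv, hy] at hxy
      | simp [hfu, hfv] at hxy
  · rcases hcase x with rfl | rfl | ⟨hx, hx1, hx2, hx3⟩ | ⟨hx, hx1, hx2, hx3⟩ <;>
      rcases hcase y with rfl | rfl | ⟨hy, hy1, hy2, hy3⟩ | ⟨hy, hy1, hy2, hy3⟩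
    all_goals first
      | (simp_all [doubleStar, starGraph, huv.ne, huv.ne', huv.symm]; done)
      | (rw [H.adj_comm]
         simp_all [doubleStar, starGraph, huv.ne, huv.ne'])

lemma IsStarForest.isIndContained {S : Type*} [Finite S] {F : SimpleGraph S}
    (h : IsStarForest F) {s : ℕ} (hs : Nat.card S ≤ s) :
    F.IsIndContained (starForest (Nat.card F.ConnectedComponent) s) := by
  obtain ⟨hac, hstar⟩ := h
  choose htree c hc using hstar
  set e : S → Fin s := fun x => Fin.castLE hs (Finite.equivFin S x) with he
  have hinj : Function.Injective e := fun x y hxy => by simpa [he] using hxy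
  set k : S → F.ConnectedComponent := F.connectedComponentMk with hk
  set d : S → S := fun x => (c (k x) : S) with hd
  have hcadj : ∀ x, x ≠ d x → F.Adj (d x) x := by
    intro x hx
    exact hc (k x) ⟨x, rfl⟩ fun e => hx (congrArg Subtype.val e)
  have hkd : ∀ x y, k x = k y → d x = d y := by
    have : ∀ C C', C = C' → (c C : S) = c C' := by rintro C _ rfl; rfl
    exact fun x y hxy => this _ _ hxy
  have hadjk : ∀ x y, F.Adj x y → k x = k y := fun x y hxy =>
    SimpleGraph.ConnectedComponent.sound hxy.reachable
  have htri : ∀ x y, F.Adj x y → x ≠ d x → y = d y := by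
    intro x y hxy hx
    by_contra hy
    have hxd := hcadj x hx
    have hyd := hcadj y hy
    rw [← hkd x y (hadjk x y hxy)] at hyd
    refine hac.cliqueFree (le_refl 3) {d x, x, y} (SimpleGraph.is3Clique_iff.2
      ⟨d x, x, y, hxd, hyd, hxy, rfl⟩)
  refine isIndContained_of_map (fun x => (Finite.equivFin _ (k x),
    if x = d x then none else some (e x))) (fun x y hxy => ?_) fun x y => ?_
  · simp only [Prod.mk.injEq, EmbeddingLike.apply_eq_iff_eq] at hxy
    obtain ⟨h1, h2⟩ := hxy
    have h3 := hkd x y h1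
    by_cases hx : x = d x <;> by_cases hy : y = d y
    · rw [hx, hy, h3]
    · rw [if_pos hx, if_neg hy] at h2; simp at h2
    · rw [if_neg hx, if_pos hy] at h2; simp at h2
    · rw [if_neg hx, if_neg hy] at h2
      exact hinj (Option.some.inj h2)
  · have hif : ∀ z, (if z = d z then none else some (e z)) = none ↔ z = d z := fun z => by
      split_ifs with h
      · exact ⟨fun _ => h, fun _ => rfl⟩
      · exact ⟨fun hh => by simp at hh, fun hh => absurd hh h⟩
    simp only [starForest, starGraph, EmbeddingLike.apply_eq_iff_eq, hif, ne_eq]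
    constructor
    · rintro ⟨h1, ⟨hx, hy⟩ | ⟨hx, hy⟩⟩
      · rw [hx, hkd x y h1]; exact hcadj y hy
      · rw [hy, ← hkd x y h1]; exact (hcadj x hx).symm
    · intro hxy
      refine ⟨hadjk x y hxy, ?_⟩
      by_cases hx : x = d x
      · refine Or.inl ⟨hx, fun hy => hxy.ne ?_⟩
        rw [hx, hy, hkd x y (hadjk x y hxy)]
      · exact Or.inr ⟨hx, htri x y hxy hx⟩

end Shapes
end PolyChi

theorem mainTheorem2 {W : Type u} {W' : Type u₁} {S : Type u₂}
    [Finite W'] [Finite S]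
    (H : SimpleGraph W) (H' : SimpleGraph W') (F : SimpleGraph S)
    (hH' : PolyChi.IsDoubleStar H') (hF : PolyChi.IsStarForest F)
    (hH : Nonempty (H ≃g (H' ⊕g F))) :
    PolyChi.SatisfiesEsperet.{u, w} H := by
  set s := Nat.card W' + Nat.card S + 1 with hs
  obtain ⟨f⟩ := hH'.isIndContained (s := s) (by omega)
  obtain ⟨g⟩ := hF.isIndContained (s := s) (by omega)
  obtain ⟨h⟩ := hH
  refine ((PolyChi.satisfiesEsperet_doubleStar (by omega : 0 < s)).sum_starForest
    (by omega : 0 < s) (Nat.card F.ConnectedComponent)).mono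
    ((SimpleGraph.IsIndContained.trans ⟨h.toEmbedding⟩) ?_)
  refine PolyChi.isIndContained_of_map (Sum.map f g) (Sum.map_injective.2 ⟨f.injective,
    g.injective⟩) ?_
  rintro (x | x) (y | y) <;> simp
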